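/- Let $n\ge 1$ and $n_1,\dots,n_n\ge 1$ be integers, let $M_r\subseteq\mathbb R^{n_r}$ be connected nonempty open sets with coordinates $(q^{r_1},\dots,q^{r_{n_r}})$, and let $M=M_1\times\dots\times M_n$. For each $r$ let $(g_r^{r_ir_j})$ be the contravariant components of a smooth pseudo-Riemannian metric on $M_r$, let $V_r$ be a smooth function on $M_r$, and let $H_r=\frac12\sum_{i,j} g_r^{r_ir_j}p_{r_i}p_{r_j}+V_r$ on $T^*M_r$. Let $\alpha^1,\dots,\alpha^n$ be smooth nowhere vanishing functions on $M$, and consider on $T^*M$ the twisted Hamiltonian $H=\sum_r\alpha^rH_r$. It is a natural Hamiltonian; let $G$ be its metric, with contravariant components $G^{r_ir_j}=\alpha^rg_r^{r_ir_j}$ and $G^{r_is_j}=0$ for $r\ne s$. The $(q^{r_i})$ are called twisted coordinates. $H$ is called *block-separated* in these coordinates if there are smooth functions $S_r^a$ ($r,a=1,\dots,n$), where $S_r^a$ depends only on the coordinates of the $r$-th block, such that at each point of $M$ the $n\times n$ matrix $S=(S_r^a)$ is invertible and $\alpha^r=(S^{-1})_1^r$ for all $r$. Then $H$ is block-separated in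 the twisted coordinates $(q^{r_i})$ if and only if there are smooth functions $\alpha_a^r$ on $M$ ($a=2,\dots,n$, $r=1,\dots,n$) such that the functions $K_a=\sum_r\alpha_a^rH_r$ on $T^*M$ satisfy: 1. $H,K_2,\dots,K_n$ are functionally independent (their differentials are linearly independent on a dense subset of $T^*M$), and $\{H,K_a\}=0$ for all $a$; 2. the symmetric 2-tensors $k_a$ given by the quadratic parts $\frac12k_a^{bc}p_bp_c$ of the $K_a$ are Killing tensors of $G$ (their Schouten brackets with $G$ vanish), they are block-diagonal in the coordinates $(q^{r_i})$, and they have common normally integrable eigenspaces. The last condition means that there are functions $\lambda_a^r$ on $M$ such that, at each point $q$ of $M$, the tangent space is the direct sum of the subspaces $E_r=\{v\in T_qM:\ k_a v=\lambda_a^r v\ \text{for all } a\}$, $r=1,\dots,n$ (where $k_a$ acts on vectors by lowering an index with $G$), $\dim E_r=n_r$, and for each $r$ the distribution $E_r^{\perp}$, orthogonal to $E_r$ with respect to $G$, is integrable (near every point it is tangent to the level sets of a smooth submersion). Moreover, for all $K_2,\dots,K_n$ of this form which satisfy 1 and 2, $\{K_a,K_b\}=0$ for all $a,b$. -/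

import Mathlib

open scoped ContDiff

namespace BlockSep

/-- Labels `(r, i)` of the coordinates `q^{r_i}`: block `r`, and `i` inside the `r`-block. -/
abbrev Idx {n : ℕ} (d : Fin n → ℕ) : Type := Σ r : Fin n, Fin (d r)

/-- Points `(q^{r_i})` of `ℝ^N`, `N = d 0 + ... + d (n - 1)`; also used for momenta `(p_{r_i})`
and for tangent vectors. -/
abbrev Config {n : ℕ} (d : Fin n → ℕ) : Type := Idx d → ℝ

/-- Phase space points `(q, p)`. -/
abbrev Phase {n : ℕ} (d : Fin n → ℕ) : Type := Config d × Config d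

/-- The coordinates (or momenta) of the `r`-block. -/
def block {n : ℕ} {d : Fin n → ℕ} (q : Config d) (r : Fin n) : Fin (d r) → ℝ :=
  fun i => q ⟨r, i⟩

/-- The product `M = M_1 × ... × M_n` of the coordinate domains `M_r = U r`. -/
def base {n : ℕ} {d : Fin n → ℕ} (U : ∀ r, Set (Fin (d r) → ℝ)) : Set (Config d) :=
  {q | ∀ r, block q r ∈ U r}

/-- The cotangent bundle `T^*M = M × ℝ^N` of the product. -/
def cotangent {n : ℕ} {d : Fin n → ℕ} (U : ∀ r, Set (Fin (d r) → ℝ)) : Set (Phase d) :=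
  {x | x.1 ∈ base U}

/-- `g` gives the contravariant components `g^{ij}` of a smooth pseudo-Riemannian metric on the
coordinate domain `U`. -/
structure IsMetricOn {k : ℕ} (U : Set (Fin k → ℝ))
    (g : (Fin k → ℝ) → Matrix (Fin k) (Fin k) ℝ) : Prop where
  smooth : ∀ i j, ContDiffOn ℝ ∞ (fun x => g x i j) U
  symm : ∀ x ∈ U, (g x).IsSymm
  nondegenerate : ∀ x ∈ U, (g x).det ≠ 0

/-- The natural Hamiltonian `½ g^{ij} p_i p_j + V`. -/
noncomputable def naturalHamiltonian {k : ℕ} (g : (Fin k → ℝ) → Matrix (Fin k) (Fin k) ℝ)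
    (V : (Fin k → ℝ) → ℝ) (q p : Fin k → ℝ) : ℝ :=
  (1 / 2) * (∑ i, ∑ j, g q i j * p i * p j) + V q

/-- The function `∑ r, α^r H_r` on phase space, where `H_r = ½ g_r^{ij} p_{r_i} p_{r_j} + V_r`
involves the `r`-block only and the `α^r` are functions of all the `q`. -/
noncomputable def twisted {n : ℕ} {d : Fin n → ℕ}
    (g : ∀ r, (Fin (d r) → ℝ) → Matrix (Fin (d r)) (Fin (d r)) ℝ)
    (V : ∀ r, (Fin (d r) → ℝ) → ℝ) (α : Fin n → Config d → ℝ) : Phase d → ℝ :=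
  fun x => ∑ r, α r x.1 * naturalHamiltonian (g r) (V r) (block x.1 r) (block x.2 r)

/-- The partial derivative `∂F/∂q^b` on phase space. -/
noncomputable def partialQ {n : ℕ} {d : Fin n → ℕ} (F : Phase d → ℝ) (b : Idx d) (x : Phase d) :
    ℝ :=
  fderiv ℝ F x (Pi.single b 1, 0)

/-- The partial derivative `∂F/∂p_b` on phase space. -/
noncomputable def partialP {n : ℕ} {d : Fin n → ℕ} (F : Phase d → ℝ) (b : Idx d) (x : Phase d) :
    ℝ :=
  fderiv ℝ F x (0, Pi.single b 1)

/-- The canonical Poisson bracket `{F, K}`. -/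
noncomputable def poisson {n : ℕ} {d : Fin n → ℕ} (F K : Phase d → ℝ) (x : Phase d) : ℝ :=
  ∑ b : Idx d, (partialQ F b x * partialP K b x - partialP F b x * partialQ K b x)

/-- The functions `F a` are functionally independent on `X`: their differentials are linearly
independent on a dense subset of `X` (never everywhere: natural Hamiltonians have critical
points). -/
def FunctionallyIndependentOn {n : ℕ} {d : Fin n → ℕ} {ι : Type} (F : ι → Phase d → ℝ)
    (X : Set (Phase d)) : Prop :=
  X ⊆ closure {x | x ∈ X ∧ LinearIndependent ℝ (fun a => fderiv ℝ (F a) x)}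

/-- The symmetric contravariant 2-tensor `k^{bc}` of a function `K = ½ k^{bc} p_b p_c + W` that is
quadratic in the momenta, recovered by polarization in the momenta. -/
noncomputable def tensor {n : ℕ} {d : Fin n → ℕ} (K : Phase d → ℝ) (q : Config d) :
    Matrix (Idx d) (Idx d) ℝ :=
  Matrix.of fun b c =>
    K (q, Pi.single b 1 + Pi.single c 1) - K (q, Pi.single b 1) - K (q, Pi.single c 1) + K (q, 0)

/-- The component `g^{lb} ∂_l k^{ce} - k^{lb} ∂_l g^{ce}`, before symmetrization in `(b, c, e)`, of
the Schouten bracket of two symmetric contravariant 2-tensor fields. -/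
noncomputable def schoutenTerm {n : ℕ} {d : Fin n → ℕ}
    (g k : Config d → Matrix (Idx d) (Idx d) ℝ) (q : Config d) (b c e : Idx d) : ℝ :=
  ∑ l : Idx d, (g q l b * fderiv ℝ (fun y => k y c e) q (Pi.single l 1)
    - k q l b * fderiv ℝ (fun y => g y c e) q (Pi.single l 1))

/-- `k` is a Killing 2-tensor of the metric `g` on `M`: their Schouten bracket `[g, k]` is zero. -/
def IsKillingOn {n : ℕ} {d : Fin n → ℕ} (M : Set (Config d))
    (g k : Config d → Matrix (Idx d) (Idx d) ℝ) : Prop :=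
  ∀ q ∈ M, (k q).IsSymm ∧ ∀ b c e : Idx d,
    schoutenTerm g k q b c e + schoutenTerm g k q c e b + schoutenTerm g k q e b c = 0

/-- The eigenspace, for the eigenvalue `μ`, of the 2-tensor `k` with respect to the metric with
contravariant components `g`, that is of the endomorphism `k^{bl} g_{lc}` of the tangent space. -/
noncomputable def tensorEigenspace {n : ℕ} {d : Fin n → ℕ} (g k : Matrix (Idx d) (Idx d) ℝ)
    (μ : ℝ) : Submodule ℝ (Config d) :=
  Module.End.eigenspace (Matrix.toLin' (k * g⁻¹)) μ

/-- The subspace orthogonal to `E` for the metric with contravariant components `g`. -/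
noncomputable def normalSpace {n : ℕ} {d : Fin n → ℕ} (g : Matrix (Idx d) (Idx d) ℝ)
    (E : Submodule ℝ (Config d)) : Submodule ℝ (Config d) :=
  LinearMap.BilinForm.orthogonal (Matrix.toBilin' g⁻¹) E

/-- The distribution `D` is integrable on `M`: near every point of `M` it is tangent to the
foliation by the level sets of a smooth submersion. -/
def IsIntegrableOn {n : ℕ} {d : Fin n → ℕ} (M : Set (Config d))
    (D : Config d → Submodule ℝ (Config d)) : Prop :=
  ∀ q ∈ M, ∃ W : Set (Config d), IsOpen W ∧ q ∈ W ∧ W ⊆ M ∧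
    ∃ (c : ℕ) (f : Config d → (Fin c → ℝ)), ContDiffOn ℝ ∞ f W ∧
      ∀ x ∈ W, Function.Surjective (fderiv ℝ f x) ∧ ∀ v, v ∈ D x ↔ fderiv ℝ f x v = 0

/-- The 2-tensors `k a` are block-diagonal in the coordinates `q^{r_i}`. -/
def AreBlockDiagonalOn {n : ℕ} {d : Fin n → ℕ} {ι : Type} (M : Set (Config d))
    (k : ι → Config d → Matrix (Idx d) (Idx d) ℝ) : Prop :=
  ∀ q ∈ M, ∀ a, ∀ b c : Idx d, b.1 ≠ c.1 → k a q b c = 0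

/-- The 2-tensors `k a` have common eigenspaces, one for each block and of the dimension of the
block, which decompose the tangent spaces and are normally integrable, that is orthogonal to the
leaves of foliations. Here `ev r a` is the eigenvalue of `k a` on the `r`-th common eigenspace, and
that eigenspace consists of *all* the common eigenvectors for the eigenvalues `(ev r a)_a`. -/
def HaveCommonNormalEigenspacesOn {n : ℕ} {d : Fin n → ℕ} {ι : Type} (M : Set (Config d))
    (g : Config d → Matrix (Idx d) (Idx d) ℝ) (k : ι → Config d → Matrix (Idx d) (Idx d) ℝ) :
    Prop :=
  ∃ ev : Fin n → ι → Config d → ℝ,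
    (∀ q ∈ M, DirectSum.IsInternal fun r => ⨅ a, tensorEigenspace (g q) (k a q) (ev r a q)) ∧
    (∀ q ∈ M, ∀ r,
      Module.finrank ℝ ↥(⨅ a, tensorEigenspace (g q) (k a q) (ev r a q)) = d r) ∧
    ∀ r, IsIntegrableOn M fun q =>
      normalSpace (g q) (⨅ a, tensorEigenspace (g q) (k a q) (ev r a q))

/-- The matrix `(S_r^a)` at the point `q`; its `r`-th row is a function of the `r`-block only. -/
def stackelMatrix {n : ℕ} {d : Fin n → ℕ} (S : ∀ r : Fin n, Fin n → (Fin (d r) → ℝ) → ℝ)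
    (q : Config d) : Matrix (Fin n) (Fin n) ℝ :=
  Matrix.of fun r a => S r a (block q r)

/-- The twisted Hamiltonian `∑ r, α^r H_r` is block-separated in the coordinates `q^{r_i}`: there
is an (invertible) block-Stäckel matrix `S` such that the `α^r` are the first row of its inverse,
so that the separated equations are `H_r = S_r^a c_a`. -/
def IsBlockSeparated {m : ℕ} {d : Fin (m + 1) → ℕ} (U : ∀ r, Set (Fin (d r) → ℝ))
    (α : Fin (m + 1) → Config d → ℝ) : Prop :=
  ∃ S : ∀ r : Fin (m + 1), Fin (m + 1) → (Fin (d r) → ℝ) → ℝ,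
    (∀ r a, ContDiffOn ℝ ∞ (S r a) (U r)) ∧
    ∀ q ∈ base U, IsUnit (stackelMatrix S q).det ∧ ∀ r, α r q = (stackelMatrix S q)⁻¹ 0 r

/-- The functions `K_a = ∑ r, β_a^r H_r`, with smooth `β_a^r`, together with `H = ∑ r, α^r H_r` are
independent, and the `K_a` are first integrals of `H`. -/
def AreFirstIntegrals {m : ℕ} {d : Fin (m + 1) → ℕ} (U : ∀ r, Set (Fin (d r) → ℝ))
    (g : ∀ r, (Fin (d r) → ℝ) → Matrix (Fin (d r)) (Fin (d r)) ℝ)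
    (V : ∀ r, (Fin (d r) → ℝ) → ℝ) (α : Fin (m + 1) → Config d → ℝ)
    (β : Fin m → Fin (m + 1) → Config d → ℝ) : Prop :=
  (∀ a r, ContDiffOn ℝ ∞ (β a r) (base U)) ∧
  FunctionallyIndependentOn
    (fun o : Option (Fin m) => o.elim (twisted g V α) fun a => twisted g V (β a)) (cotangent U) ∧
  ∀ a, ∀ x ∈ cotangent U, poisson (twisted g V α) (twisted g V (β a)) x = 0

/-- The 2-tensors `k_a` of the `K_a = ∑ r, β_a^r H_r` are Killing tensors of the metric of
`H = ∑ r, α^r H_r`, simultaneously block-diagonalized with common normally integrable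
eigenspaces. -/
def HaveBlockKillingTensors {m : ℕ} {d : Fin (m + 1) → ℕ} (U : ∀ r, Set (Fin (d r) → ℝ))
    (g : ∀ r, (Fin (d r) → ℝ) → Matrix (Fin (d r)) (Fin (d r)) ℝ)
    (V : ∀ r, (Fin (d r) → ℝ) → ℝ) (α : Fin (m + 1) → Config d → ℝ)
    (β : Fin m → Fin (m + 1) → Config d → ℝ) : Prop :=
  (∀ a, IsKillingOn (base U) (tensor (twisted g V α)) (tensor (twisted g V (β a)))) ∧
  AreBlockDiagonalOn (base U) (fun a => tensor (twisted g V (β a))) ∧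
  HaveCommonNormalEigenspacesOn (base U) (tensor (twisted g V α))
    (fun a => tensor (twisted g V (β a)))

end BlockSep

namespace BlockSep

open Filter Topology Matrix

/-! Everything reduces to one linear system of first order equations for the coefficients. In the
bracket of `∑ γ^r H_r` and `∑ δ^r H_r` only derivatives of the coefficients survive, and since each
`H_s` is quadratic and nondegenerate in its own momenta, the bracket vanishes over a point iff `δ^r
∂_b γ^s = γ^r ∂_b δ^s` there, for every coordinate `b` of block `r` and every `s`
(`poisson_twisted_eq_zero_iff`).

From a block-Stäckel matrix `S` to the integrals: row `r` of `S` depends on block `r` only, so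
`d(S⁻¹) = -S⁻¹ dS S⁻¹` shows that along block `r` the derivative of `S⁻¹` is column `r` of `S⁻¹`
times a row vector (`exists_fderiv_inv_stackelMatrix`). Hence any two rows of `S⁻¹` satisfy the
system. The rows below the first give the `K_a`; the system also makes their tensors Killing, with
eigenvalues `β_a^r / α^r`, which separate the blocks because `S⁻¹` is invertible.

Conversely, let `A` have rows `α` and the `β_a`. The system reads `∂_b A_a^s = A_a^r (∂_b α^s /
α^r)`, so a linear relation between the rows of `A` at one point persists nearby by Grönwall
(`eventually_vecMul_eq_zero`). This would contradict independence on a dense set, so `A` is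
invertible at every point. Inserting the system into `d(A⁻¹)` shows that row `r` of `A⁻¹` is
constant along the other blocks, so `A⁻¹` is block-Stäckel (`exists_stackelMatrix_eq_inv`).

Involution of `K_a` and `K_b` follows by eliminating the derivatives of `α` from their two systems.
-/

/-! ### Vanishing criteria from analysis and algebra -/

/-- Grönwall's inequality on each segment issuing from `q₀` inside a ball where the bound holds. -/
theorem eventually_eq_zero_of_norm_fderiv_le {E F : Type*} [NormedAddCommGroup E]
    [NormedSpace ℝ E] [NormedAddCommGroup F] [NormedSpace ℝ F] {u : E → F} {q₀ : E} {C : ℝ}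
    (h : ∀ᶠ q in 𝓝 q₀, DifferentiableAt ℝ u q ∧ ‖fderiv ℝ u q‖ ≤ C * ‖u q‖) (h₀ : u q₀ = 0) :
    ∀ᶠ q in 𝓝 q₀, u q = 0 := by
  obtain ⟨ε, hε, hball⟩ := Metric.eventually_nhds_iff_ball.1 h
  refine Metric.eventually_nhds_iff_ball.2 ⟨ε, hε, fun q hq => ?_⟩
  set v := q - q₀ with hv
  have hmem : ∀ t ∈ Set.Icc (0 : ℝ) 1, q₀ + t • v ∈ Metric.ball q₀ ε := by
    intro t ht
    rw [Metric.mem_ball, dist_eq_norm, add_sub_cancel_left, norm_smul, Real.norm_eq_abs,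
      abs_of_nonneg ht.1]
    rw [Metric.mem_ball, dist_eq_norm] at hq
    exact lt_of_le_of_lt (mul_le_of_le_one_left (norm_nonneg _) ht.2) hq
  have hder : ∀ t ∈ Set.Icc (0 : ℝ) 1,
      HasDerivAt (fun t : ℝ => u (q₀ + t • v)) (fderiv ℝ u (q₀ + t • v) v) t := by
    intro t ht
    have h1 : HasDerivAt (fun t : ℝ => q₀ + t • v) v t := by
      simpa using ((hasDerivAt_id t).smul_const v).const_add q₀
    exact ((hball _ (hmem t ht)).1.hasFDerivAt).comp_hasDerivAt t h1
  have key := eq_zero_of_abs_deriv_le_mul_abs_self_of_eq_zero_right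
    (f := fun t : ℝ => u (q₀ + t • v)) (f' := fun t => fderiv ℝ u (q₀ + t • v) v)
    (K := C * ‖v‖) (a := 0) (b := 1)
    (fun t ht => (hder t ht).continuousAt.continuousWithinAt)
    (fun t ht => (hder t ⟨ht.1, ht.2.le⟩).hasDerivWithinAt) (by simpa using h₀)
    (fun t ht => by
      have h2 := (hball _ (hmem t ⟨ht.1, ht.2.le⟩)).2
      calc ‖fderiv ℝ u (q₀ + t • v) v‖ ≤ ‖fderiv ℝ u (q₀ + t • v)‖ * ‖v‖ :=
            ContinuousLinearMap.le_opNorm _ _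
        _ ≤ C * ‖u (q₀ + t • v)‖ * ‖v‖ := by gcongr
        _ = C * ‖v‖ * ‖u (q₀ + t • v)‖ := by ring)
    1 ⟨zero_le_one, le_rfl⟩
  simpa [hv] using key

/-- Evaluating the cubic part at `U` isolates the index `s` and gives `X s U = 0`; its first
variation at `U` in direction `W` then reduces to `B s U U * X s W`. In the application `B s` is the
kinetic part of `H_s` and `c s` the value of its potential. -/
theorem eq_zero_of_sum_quadratic_mul_linear {ι P : Type*} [Fintype ι] [AddCommGroup P]
    [Module ℝ P] (B : ι → P →ₗ[ℝ] P →ₗ[ℝ] ℝ) (c : ι → ℝ) (X : ι → P →ₗ[ℝ] ℝ)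
    (h : ∀ p, ∑ s, (B s p p + c s) * X s p = 0) {s : ι} {U : P} (hU : B s U U ≠ 0)
    (hU' : ∀ t ≠ s, ∀ W, B t U W = 0 ∧ B t W U = 0) : X s = 0 := by
  -- Scaling `p` by 2 separates the cubic part from the linear part: `8 - 2 = 6`.
  have hC : ∀ p, ∑ s, B s p p * X s p = 0 := by
    intro p
    have h1 := h p
    have h2 := h ((2 : ℝ) • p)
    have h3 : ∑ s, (B s ((2 : ℝ) • p) ((2 : ℝ) • p) + c s) * X s ((2 : ℝ) • p)
        - 2 * ∑ s, (B s p p + c s) * X s p = 6 * ∑ s, B s p p * X s p := by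
      rw [Finset.mul_sum, Finset.mul_sum, ← Finset.sum_sub_distrib]
      refine Finset.sum_congr rfl fun t _ => ?_
      simp only [map_smul, LinearMap.smul_apply, smul_eq_mul]
      ring
    rw [h1, h2] at h3
    linarith
  have hsingle : ∀ W, ∑ t, (B t U U * X t W + (B t U W + B t W U) * X t U) =
      B s U U * X s W + (B s U W + B s W U) * X s U := by
    intro W
    refine Finset.sum_eq_single s (fun t _ hts => ?_) (by simp)
    rw [(hU' t hts W).1, (hU' t hts W).2, (hU' t hts U).1]
    ring
  have hXU : X s U = 0 := by
    have h1 := hC U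
    rw [Finset.sum_eq_single s (fun t _ hts => by rw [(hU' t hts U).1, zero_mul]) (by simp)] at h1
    exact (mul_eq_zero.1 h1).resolve_left hU
  ext W
  -- For a cubic polynomial `f`, `8 (f 1 - f (-1)) - (f 2 - f (-2))` is 12 times the linear
  -- coefficient; here `f` is the cubic part on the line through `U` in direction `W`.
  have h4 : 12 * ∑ t, (B t U U * X t W + (B t U W + B t W U) * X t U) =
      8 * (∑ t, B t (U + W) (U + W) * X t (U + W) - ∑ t, B t (U - W) (U - W) * X t (U - W))
      - (∑ t, B t (U + (2 : ℝ) • W) (U + (2 : ℝ) • W) * X t (U + (2 : ℝ) • W)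
        - ∑ t, B t (U - (2 : ℝ) • W) (U - (2 : ℝ) • W) * X t (U - (2 : ℝ) • W)) := by
    simp only [← Finset.sum_sub_distrib, Finset.mul_sum]
    refine Finset.sum_congr rfl fun t _ => ?_
    simp only [map_add, map_sub, map_smul, LinearMap.add_apply, LinearMap.sub_apply,
      LinearMap.smul_apply, smul_eq_mul]
    ring
  rw [hC, hC, hC, hC, hsingle, hXU] at h4
  have h5 : B s U U * X s W = 0 := by linarith
  exact (mul_eq_zero.1 h5).resolve_left hU

/-- By polarization, a symmetric form with no non-isotropic vector is zero. The size must be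
positive because the empty matrix has determinant 1. -/
theorem exists_dotProduct_mulVec_ne_zero {k : ℕ} (hk : 1 ≤ k) {A : Matrix (Fin k) (Fin k) ℝ}
    (hs : A.IsSymm) (hA : A.det ≠ 0) : ∃ u : Fin k → ℝ, u ⬝ᵥ A *ᵥ u ≠ 0 := by
  by_contra! h
  have hdiag : ∀ i, A i i = 0 := fun i => by simpa using h (Pi.single i 1)
  have h0 : A = 0 := by
    ext i j
    have h1 := h (Pi.single i 1 + Pi.single j 1)
    have h2 := hs.apply i j
    simp [add_dotProduct, dotProduct_add, mulVec_add, hdiag] at h1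
    simp only [Matrix.zero_apply]
    linarith
  have : Nonempty (Fin k) := ⟨⟨0, hk⟩⟩
  exact hA (by rw [h0, Matrix.det_zero])

/-! ### Smoothness and derivative of the inverse matrix -/

section Smooth

variable {E : Type*} [NormedAddCommGroup E] [NormedSpace ℝ E] {ι : Type*} [Fintype ι]
  [DecidableEq ι]

theorem contDiffOn_det {A : E → Matrix ι ι ℝ} {s : Set E}
    (hA : ∀ i j, ContDiffOn ℝ ∞ (fun y => A y i j) s) :
    ContDiffOn ℝ ∞ (fun y => (A y).det) s := by
  simp only [Matrix.det_apply']
  exact ContDiffOn.sum fun σ _ => contDiffOn_const.mul (contDiffOn_prod fun i _ => hA _ _)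

theorem contDiffOn_inv_apply {A : E → Matrix ι ι ℝ} {s : Set E}
    (hA : ∀ i j, ContDiffOn ℝ ∞ (fun y => A y i j) s) (h0 : ∀ y ∈ s, (A y).det ≠ 0) (i j : ι) :
    ContDiffOn ℝ ∞ (fun y => (A y)⁻¹ i j) s := by
  simp only [Matrix.inv_def, Matrix.smul_apply, Ring.inverse_eq_inv', smul_eq_mul,
    Matrix.adjugate_apply]
  refine ((contDiffOn_det hA).inv h0).mul (contDiffOn_det fun k l => ?_)
  by_cases hk : k = j
  · subst hk
    simpa using contDiffOn_const
  · simpa [Matrix.updateRow_ne hk] using hA k l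

/-- Differentiation of the inverse: `d(A⁻¹) = - A⁻¹ (dA) A⁻¹`. -/
theorem fderiv_inv_apply {A : E → Matrix ι ι ℝ} {q : E}
    (hA : ∀ i j, DifferentiableAt ℝ (fun y => A y i j) q)
    (hB : ∀ i j, DifferentiableAt ℝ (fun y => (A y)⁻¹ i j) q)
    (h0 : ∀ᶠ y in 𝓝 q, (A y).det ≠ 0) (v : E) (i j : ι) :
    fderiv ℝ (fun y => (A y)⁻¹ i j) q v =
      -∑ k, ∑ l, (A q)⁻¹ i k * fderiv ℝ (fun y => A y k l) q v * (A q)⁻¹ l j := by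
  set dA : Matrix ι ι ℝ := Matrix.of fun k l => fderiv ℝ (fun y => A y k l) q v with hdA
  set dB : Matrix ι ι ℝ := Matrix.of fun k l => fderiv ℝ (fun y => (A y)⁻¹ k l) q v with hdB
  have hunit : IsUnit (A q).det := h0.self_of_nhds.isUnit
  -- Leibniz rule applied to `A⁻¹ A = 1`, which holds on a neighbourhood of `q`.
  have hzero : dB * A q + (A q)⁻¹ * dA = 0 := by
    ext k l
    have h1 : (fun y => ∑ m, (A y)⁻¹ k m * A y m l) =ᶠ[𝓝 q] fun _ => (1 : Matrix ι ι ℝ) k l := by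
      filter_upwards [h0] with y hy
      rw [← Matrix.mul_apply, Matrix.nonsing_inv_mul _ hy.isUnit]
    have h2 := h1.fderiv_eq (𝕜 := ℝ)
    rw [fderiv_fun_sum fun m _ => (hB k m).fun_mul (hA m l)] at h2
    have h3 := congrArg (fun L : E →L[ℝ] ℝ => L v) h2
    simp only [_root_.sum_apply, fderiv_fun_mul (hB k _) (hA _ l),
      _root_.add_apply, _root_.smul_apply, smul_eq_mul,
      fderiv_fun_const, Pi.zero_apply, _root_.zero_apply,
      Finset.sum_add_distrib] at h3
    simp only [Matrix.add_apply, Matrix.mul_apply, hdA, hdB, Matrix.of_apply, Matrix.zero_apply]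
    rw [← h3, add_comm]
    congr 1
    exact Finset.sum_congr rfl fun m _ => mul_comm _ _
  have h4 : dB = -((A q)⁻¹ * dA * (A q)⁻¹) := by
    calc dB = dB * A q * (A q)⁻¹ := (Matrix.mul_nonsing_inv_cancel_right _ _ hunit).symm
      _ = -((A q)⁻¹ * dA * (A q)⁻¹) := by
        rw [eq_neg_of_add_eq_zero_left hzero, Matrix.neg_mul]
  have h5 := congrFun (congrFun h4 i) j
  simp only [hdB, Matrix.of_apply] at h5
  rw [h5, Matrix.neg_apply, Matrix.mul_apply]
  simp only [Matrix.mul_apply, Finset.sum_mul, hdA, Matrix.of_apply]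
  rw [Finset.sum_comm]

end Smooth

/-! ### Block coordinates and functions of a single block -/

section Blocks

variable {n : ℕ} {d : Fin n → ℕ}

/-- The point with given blocks. -/
def ofBlocks (x : ∀ r, Fin (d r) → ℝ) : Config d := fun b => x b.1 b.2

@[simp] theorem block_ofBlocks (x : ∀ r, Fin (d r) → ℝ) (r : Fin n) : block (ofBlocks x) r = x r :=
  rfl

theorem ofBlocks_block (q : Config d) : ofBlocks (fun r => block q r) = q := rfl

@[simp] theorem block_add (p p' : Config d) (r : Fin n) :
    block (p + p') r = block p r + block p' r := rfl

@[simp] theorem block_smul (t : ℝ) (p : Config d) (r : Fin n) :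
    block (t • p) r = t • block p r := rfl

theorem block_single_self (r : Fin n) (i : Fin (d r)) (t : ℝ) :
    block (Pi.single (⟨r, i⟩ : Idx d) t) r = Pi.single i t := by
  ext j
  by_cases h : j = i
  · subst h; simp [block]
  · have : (⟨r, j⟩ : Idx d) ≠ ⟨r, i⟩ := fun e => h (by simpa using e)
    simp [block, h]

theorem block_single_of_ne {b : Idx d} {s : Fin n} (h : s ≠ b.1) (t : ℝ) :
    block (Pi.single b t : Config d) s = 0 := by
  ext j
  have : (⟨s, j⟩ : Idx d) ≠ b := fun e => h (by rw [← e])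
  simp [block, this]

/-- The coordinates of a block as a continuous linear map. -/
def blockCLM (d : Fin n → ℕ) (r : Fin n) : Config d →L[ℝ] (Fin (d r) → ℝ) :=
  ContinuousLinearMap.pi fun i => ContinuousLinearMap.proj (⟨r, i⟩ : Idx d)

@[simp] theorem blockCLM_apply (q : Config d) (r : Fin n) : blockCLM d r q = block q r := rfl

theorem contDiff_block (r : Fin n) : ContDiff ℝ ∞ (fun q : Config d => block q r) :=
  (blockCLM d r).contDiff

theorem isOpen_base {U : ∀ r, Set (Fin (d r) → ℝ)} (hU : ∀ r, IsOpen (U r)) :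
    IsOpen (base U) := by
  have : base U = ⋂ r, (fun q : Config d => block q r) ⁻¹' U r := by
    ext q; simp [base]
  rw [this]
  exact isOpen_iInter_of_finite fun r => (hU r).preimage (contDiff_block r).continuous

theorem isPreconnected_base {U : ∀ r, Set (Fin (d r) → ℝ)} (hU : ∀ r, IsPreconnected (U r)) :
    IsPreconnected (base U) := by
  have hc : Continuous (ofBlocks : (∀ r, Fin (d r) → ℝ) → Config d) :=
    continuous_pi fun b => (continuous_apply b.2).comp (continuous_apply b.1)
  have : base U = ofBlocks '' Set.pi Set.univ U := by
    ext q
    constructor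
    · intro hq
      exact ⟨fun r => block q r, fun r _ => hq r, rfl⟩
    · rintro ⟨x, hx, rfl⟩ r
      exact hx r trivial
  rw [this]
  exact (isPreconnected_univ_pi hU).image _ hc.continuousOn

theorem base_nonempty {U : ∀ r, Set (Fin (d r) → ℝ)} (hU : ∀ r, (U r).Nonempty) :
    (base U).Nonempty :=
  ⟨ofBlocks fun r => (hU r).choose, fun r => (hU r).choose_spec⟩

/-- The partial derivatives of a function of the `s`-block along the other blocks vanish. -/
theorem fderiv_comp_block_single {s : Fin n} {f : (Fin (d s) → ℝ) → ℝ} {q : Config d}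
    (hf : DifferentiableAt ℝ f (block q s)) {b : Idx d} (h : s ≠ b.1) :
    fderiv ℝ (fun y : Config d => f (block y s)) q (Pi.single b 1) = 0 := by
  have h1 : HasFDerivAt (fun y : Config d => f (block y s))
      ((fderiv ℝ f (block q s)).comp (blockCLM d s)) q :=
    HasFDerivAt.comp q (f := blockCLM d s) hf.hasFDerivAt (blockCLM d s).hasFDerivAt
  rw [h1.fderiv, ContinuousLinearMap.comp_apply, blockCLM_apply, block_single_of_ne h, map_zero]

theorem fderiv_eq_zero_of_single {F : Type*} [NormedAddCommGroup F] [NormedSpace ℝ F]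
    {L : Config d →L[ℝ] F} (v : Config d) (h : ∀ b, v b ≠ 0 → L (Pi.single b 1) = 0) :
    L v = 0 := by
  rw [pi_eq_sum_univ' v, map_sum]
  refine Finset.sum_eq_zero fun b _ => ?_
  rw [map_smul]
  by_cases hb : v b = 0
  · rw [hb, zero_smul]
  · have := h b hb
    simp only [Pi.single] at this ⊢
    convert smul_zero (v b)

/-- A function whose partial derivatives along all blocks except the `s`-th vanish depends on the
`s`-block only. -/
theorem eq_of_block_eq {U : ∀ r, Set (Fin (d r) → ℝ)} (hUo : ∀ r, IsOpen (U r))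
    (hUc : ∀ r, IsPreconnected (U r)) {f : Config d → ℝ} {s : Fin n}
    (hf : DifferentiableOn ℝ f (base U))
    (h : ∀ q ∈ base U, ∀ b : Idx d, b.1 ≠ s → fderiv ℝ f q (Pi.single b 1) = 0)
    {q q' : Config d} (hq : q ∈ base U) (hq' : q' ∈ base U) (hqq : block q s = block q' s) :
    f q = f q' := by
  -- The affine map `y ↦ c + L y` replaces the `s`-block of `y` by that of `q`. Its differential
  -- takes values in the other blocks, where the partial derivatives of `f` vanish, so `f (c + L y)`
  -- is constant on the connected base; it equals `f q` at `q` and `f q'` at `q'`.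
  let L : Config d →L[ℝ] Config d :=
    ContinuousLinearMap.pi fun b => if b.1 = s then 0 else ContinuousLinearMap.proj b
  let c : Config d := fun b => if b.1 = s then q b else 0
  have hL : ∀ y b, (c + L y) b = if b.1 = s then q b else y b := by
    intro y b
    by_cases hb : b.1 = s <;> simp [c, L, hb]
  have hblock : ∀ y r, block (c + L y) r = if r = s then block q r else block y r := by
    intro y r
    ext i
    by_cases hr : r = s <;> simp [block, -Pi.add_apply, hL, hr]
  have hmem : ∀ y ∈ base U, c + L y ∈ base U := by
    intro y hy r
    rw [hblock]
    split_ifs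
    exacts [hq r, hy r]
  have hder : ∀ y ∈ base U, HasFDerivAt (fun y => f (c + L y))
      ((fderiv ℝ f (c + L y)).comp L) y := by
    intro y hy
    have h1 := (hf _ (hmem y hy)).differentiableAt ((isOpen_base hUo).mem_nhds (hmem y hy))
    exact h1.hasFDerivAt.comp y (L.hasFDerivAt.const_add c)
  have key := (isOpen_base hUo).is_const_of_fderiv_eq_zero (𝕜 := ℝ) (f := fun y => f (c + L y))
    (isPreconnected_base hUc) (fun y hy => (hder y hy).differentiableAt.differentiableWithinAt)
    (fun y hy => by
      rw [(hder y hy).fderiv]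
      ext v
      simp only [ContinuousLinearMap.comp_apply, Pi.zero_apply, _root_.zero_apply]
      refine fderiv_eq_zero_of_single _ fun b hb => h _ (hmem y hy) b fun hbs => hb ?_
      simp [L, hbs]) hq hq'
  have e1 : c + L q = q := by ext b; rw [hL]; simp
  have e2 : c + L q' = q' := by
    rw [← ofBlocks_block (c + L q'), ← ofBlocks_block q']
    congr 1
    ext1 r
    rw [hblock]
    split_ifs with hr
    · subst hr; exact hqq
    · rfl
  simpa only [e1, e2] using key

end Blocks

/-! ### The Hamiltonian of one block -/

theorem naturalHamiltonian_eq {k : ℕ} (g : (Fin k → ℝ) → Matrix (Fin k) (Fin k) ℝ)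
    (V : (Fin k → ℝ) → ℝ) (q p : Fin k → ℝ) :
    naturalHamiltonian g V q p = (1 / 2) * (p ⬝ᵥ g q *ᵥ p) + V q := by
  simp only [naturalHamiltonian, dotProduct, mulVec, Finset.mul_sum]
  congr 1
  refine Finset.sum_congr rfl fun i _ => Finset.sum_congr rfl fun j _ => ?_
  ring

section NaturalHamiltonian

variable {k : ℕ} {U : Set (Fin k → ℝ)} {g : (Fin k → ℝ) → Matrix (Fin k) (Fin k) ℝ}
  {V : (Fin k → ℝ) → ℝ}

theorem differentiableAt_naturalHamiltonian (hU : IsOpen U) (hg : IsMetricOn U g)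
    (hV : ContDiffOn ℝ ∞ V U) {q : Fin k → ℝ} (hq : q ∈ U) (p : Fin k → ℝ) :
    DifferentiableAt ℝ (fun z : (Fin k → ℝ) × (Fin k → ℝ) => naturalHamiltonian g V z.1 z.2)
      (q, p) := by
  have h1 : ∀ f : (Fin k → ℝ) → ℝ, ContDiffOn ℝ ∞ f U →
      DifferentiableAt ℝ (fun z : (Fin k → ℝ) × (Fin k → ℝ) => f z.1) (q, p) := by
    intro f hf
    have h2 : DifferentiableAt ℝ f q :=
      (hf.differentiableOn (by simp)).differentiableAt (hU.mem_nhds hq)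
    exact DifferentiableAt.comp (q, p) (g := f) h2 differentiableAt_fst
  have h3 : ∀ i, DifferentiableAt ℝ (fun z : (Fin k → ℝ) × (Fin k → ℝ) => z.2 i) (q, p) :=
    fun i => by fun_prop
  unfold naturalHamiltonian
  refine DifferentiableAt.add (DifferentiableAt.const_mul ?_ _) (h1 V hV)
  exact DifferentiableAt.fun_sum fun i _ => DifferentiableAt.fun_sum fun j _ =>
    ((h1 _ (hg.smooth i j)).mul (h3 i)).mul (h3 j)

theorem fderiv_naturalHamiltonian_momentum (hU : IsOpen U) (hg : IsMetricOn U g)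
    (hV : ContDiffOn ℝ ∞ V U) {q : Fin k → ℝ} (hq : q ∈ U) (p w : Fin k → ℝ) :
    fderiv ℝ (fun z : (Fin k → ℝ) × (Fin k → ℝ) => naturalHamiltonian g V z.1 z.2) (q, p) (0, w)
      = w ⬝ᵥ g q *ᵥ p := by
  -- Along a momentum line the Hamiltonian is an explicit quadratic polynomial in `t`, whose linear
  -- coefficient is the answer.
  rw [← (differentiableAt_naturalHamiltonian hU hg hV hq p).lineDeriv_eq_fderiv, lineDeriv]
  have hsymm : p ⬝ᵥ g q *ᵥ w = w ⬝ᵥ g q *ᵥ p := by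
    rw [dotProduct_mulVec, ← mulVec_transpose, (hg.symm q hq).eq, dotProduct_comm]
  have h1 : (fun t : ℝ => naturalHamiltonian g V ((q, p) + t • ((0 : Fin k → ℝ), w)).1
      ((q, p) + t • ((0 : Fin k → ℝ), w)).2) = fun t : ℝ => naturalHamiltonian g V q p
        + t * (w ⬝ᵥ g q *ᵥ p) + t ^ 2 * ((1 / 2) * (w ⬝ᵥ g q *ᵥ w)) := by
    ext t
    simp only [naturalHamiltonian_eq, Prod.fst_add, Prod.snd_add, Prod.smul_fst, Prod.smul_snd,
      smul_zero, add_zero, mulVec_add, mulVec_smul, add_dotProduct, dotProduct_add,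
      smul_dotProduct, dotProduct_smul, smul_eq_mul, hsymm]
    ring
  rw [h1]
  have h2 := (((hasDerivAt_id (0 : ℝ)).mul_const (w ⬝ᵥ g q *ᵥ p)).const_add
    (naturalHamiltonian g V q p)).fun_add
      (((hasDerivAt_id (0 : ℝ)).fun_pow 2).mul_const ((1 / 2) * (w ⬝ᵥ g q *ᵥ w)))
  refine HasDerivAt.deriv ?_
  convert h2 using 1 <;> simp

end NaturalHamiltonian

/-! ### Poisson brackets of twisted Hamiltonians -/

section Twisted

variable {n : ℕ} {d : Fin n → ℕ} {U : ∀ r, Set (Fin (d r) → ℝ)}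
  {g : ∀ r, (Fin (d r) → ℝ) → Matrix (Fin (d r)) (Fin (d r)) ℝ}
  {V : ∀ r, (Fin (d r) → ℝ) → ℝ}

/-- The Hamiltonian `H_s` of the `s`-block as a function on the whole phase space. -/
noncomputable def blockHamiltonian (g : ∀ r, (Fin (d r) → ℝ) → Matrix (Fin (d r)) (Fin (d r)) ℝ)
    (V : ∀ r, (Fin (d r) → ℝ) → ℝ) (s : Fin n) : Phase d → ℝ :=
  fun x => naturalHamiltonian (g s) (V s) (block x.1 s) (block x.2 s)

/-- The partial derivative `∂H_r/∂p_{r_i} = ∑ j, g_r^{ij} p_{r_j}`. -/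
noncomputable def velocity (g : ∀ r, (Fin (d r) → ℝ) → Matrix (Fin (d r)) (Fin (d r)) ℝ)
    (q p : Config d) (b : Idx d) : ℝ :=
  (g b.1 (block q b.1) *ᵥ block p b.1) b.2

theorem hasFDerivAt_blockHamiltonian (hU : ∀ r, IsOpen (U r)) (hg : ∀ r, IsMetricOn (U r) (g r))
    (hV : ∀ r, ContDiffOn ℝ ∞ (V r) (U r)) {x : Phase d} (hx : x ∈ cotangent U) (s : Fin n) :
    HasFDerivAt (blockHamiltonian g V s)
      ((fderiv ℝ (fun z : (Fin (d s) → ℝ) × (Fin (d s) → ℝ) =>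
        naturalHamiltonian (g s) (V s) z.1 z.2) (block x.1 s, block x.2 s)).comp
          ((blockCLM d s).prodMap (blockCLM d s))) x :=
  HasFDerivAt.comp x (f := (blockCLM d s).prodMap (blockCLM d s))
    (differentiableAt_naturalHamiltonian (hU s) (hg s) (hV s) (hx s) _).hasFDerivAt
    ((blockCLM d s).prodMap (blockCLM d s)).hasFDerivAt

theorem blockCLM_prodMap_apply (s : Fin n) (v : Phase d) :
    ((blockCLM d s).prodMap (blockCLM d s)) v = (block v.1 s, block v.2 s) := rfl

theorem fderiv_blockHamiltonian_of_ne (hU : ∀ r, IsOpen (U r))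
    (hg : ∀ r, IsMetricOn (U r) (g r)) (hV : ∀ r, ContDiffOn ℝ ∞ (V r) (U r)) {x : Phase d}
    (hx : x ∈ cotangent U) {s : Fin n} {v : Phase d} (h1 : block v.1 s = 0)
    (h2 : block v.2 s = 0) : fderiv ℝ (blockHamiltonian g V s) x v = 0 := by
  rw [(hasFDerivAt_blockHamiltonian hU hg hV hx s).fderiv]
  simp only [ContinuousLinearMap.comp_apply, blockCLM_prodMap_apply, h1, h2]
  exact map_zero _

theorem fderiv_twisted (hU : ∀ r, IsOpen (U r)) (hg : ∀ r, IsMetricOn (U r) (g r))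
    (hV : ∀ r, ContDiffOn ℝ ∞ (V r) (U r)) {γ : Fin n → Config d → ℝ} {x : Phase d}
    (hx : x ∈ cotangent U) (hγ : ∀ r, DifferentiableAt ℝ (γ r) x.1) (v : Phase d) :
    fderiv ℝ (twisted g V γ) x v = ∑ s, (γ s x.1 * fderiv ℝ (blockHamiltonian g V s) x v
      + blockHamiltonian g V s x * fderiv ℝ (γ s) x.1 v.1) := by
  have h1 : ∀ s, HasFDerivAt (fun x : Phase d => γ s x.1)
      ((fderiv ℝ (γ s) x.1).comp (ContinuousLinearMap.fst ℝ _ _)) x :=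
    fun s => (hγ s).hasFDerivAt.comp x hasFDerivAt_fst
  have h2 : ∀ s, HasFDerivAt (fun x => γ s x.1 * blockHamiltonian g V s x) _ x :=
    fun s => (h1 s).mul
      (hasFDerivAt_blockHamiltonian hU hg hV hx s).differentiableAt.hasFDerivAt
  have h3 : HasFDerivAt (twisted g V γ) _ x := 
    HasFDerivAt.fun_sum fun s (_ : s ∈ Finset.univ) => h2 s
  rw [h3.fderiv]
  simp [_root_.sum_apply]

theorem partialP_twisted (hU : ∀ r, IsOpen (U r)) (hg : ∀ r, IsMetricOn (U r) (g r))
    (hV : ∀ r, ContDiffOn ℝ ∞ (V r) (U r)) {γ : Fin n → Config d → ℝ} {x : Phase d}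
    (hx : x ∈ cotangent U) (hγ : ∀ r, DifferentiableAt ℝ (γ r) x.1) (b : Idx d) :
    partialP (twisted g V γ) b x = γ b.1 x.1 * velocity g x.1 x.2 b := by
  rw [partialP, fderiv_twisted hU hg hV hx hγ, Finset.sum_eq_single b.1]
  · obtain ⟨r, i⟩ := b
    rw [(hasFDerivAt_blockHamiltonian hU hg hV hx r).fderiv]
    simp only [ContinuousLinearMap.comp_apply, blockCLM_prodMap_apply, map_zero, mul_zero, add_zero,
      block_single_self]
    have := fderiv_naturalHamiltonian_momentum (hU r) (hg r) (hV r) (hx r) (block x.2 r)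
      (Pi.single i 1)
    rw [single_one_dotProduct] at this
    rw [velocity, ← this]
    rfl
  · intro s _ hs
    rw [fderiv_blockHamiltonian_of_ne hU hg hV hx rfl (block_single_of_ne hs 1), map_zero]
    simp
  · simp

theorem partialQ_twisted (hU : ∀ r, IsOpen (U r)) (hg : ∀ r, IsMetricOn (U r) (g r))
    (hV : ∀ r, ContDiffOn ℝ ∞ (V r) (U r)) {γ : Fin n → Config d → ℝ} {x : Phase d}
    (hx : x ∈ cotangent U) (hγ : ∀ r, DifferentiableAt ℝ (γ r) x.1) (b : Idx d) :
    partialQ (twisted g V γ) b x = γ b.1 x.1 * partialQ (blockHamiltonian g V b.1) b x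
      + ∑ s, blockHamiltonian g V s x * fderiv ℝ (γ s) x.1 (Pi.single b 1) := by
  rw [partialQ, fderiv_twisted hU hg hV hx hγ, Finset.sum_add_distrib]
  congr 1
  refine Finset.sum_eq_single _ (fun s _ hs => ?_) (by simp)
  rw [fderiv_blockHamiltonian_of_ne hU hg hV hx (block_single_of_ne hs 1) rfl, mul_zero]

/-- The terms containing derivatives of the block Hamiltonians with respect to `q` cancel: for `b`
in block `r`, both halves of the bracket contribute `γ^r δ^r ∂H_r/∂q^b ∂H_r/∂p_b`. -/
theorem poisson_twisted (hU : ∀ r, IsOpen (U r)) (hg : ∀ r, IsMetricOn (U r) (g r))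
    (hV : ∀ r, ContDiffOn ℝ ∞ (V r) (U r)) {γ δ : Fin n → Config d → ℝ} {x : Phase d}
    (hx : x ∈ cotangent U) (hγ : ∀ r, DifferentiableAt ℝ (γ r) x.1)
    (hδ : ∀ r, DifferentiableAt ℝ (δ r) x.1) :
    poisson (twisted g V γ) (twisted g V δ) x = ∑ s, blockHamiltonian g V s x *
      ∑ b, velocity g x.1 x.2 b * (δ b.1 x.1 * fderiv ℝ (γ s) x.1 (Pi.single b 1)
        - γ b.1 x.1 * fderiv ℝ (δ s) x.1 (Pi.single b 1)) := by
  simp only [Finset.mul_sum]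
  rw [poisson, Finset.sum_comm]
  refine Finset.sum_congr rfl fun b _ => ?_
  rw [partialQ_twisted hU hg hV hx hγ, partialQ_twisted hU hg hV hx hδ,
    partialP_twisted hU hg hV hx hγ, partialP_twisted hU hg hV hx hδ]
  have : ∑ s, blockHamiltonian g V s x * (velocity g x.1 x.2 b *
      (δ b.1 x.1 * fderiv ℝ (γ s) x.1 (Pi.single b 1)
        - γ b.1 x.1 * fderiv ℝ (δ s) x.1 (Pi.single b 1))) =
      velocity g x.1 x.2 b * δ b.1 x.1 *
        ∑ s, blockHamiltonian g V s x * fderiv ℝ (γ s) x.1 (Pi.single b 1)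
      - velocity g x.1 x.2 b * γ b.1 x.1 *
        ∑ s, blockHamiltonian g V s x * fderiv ℝ (δ s) x.1 (Pi.single b 1) := by
    rw [Finset.mul_sum, Finset.mul_sum, ← Finset.sum_sub_distrib]
    exact Finset.sum_congr rfl fun s _ => by ring
  rw [this]
  ring

theorem sum_single_velocity_mul {g : ∀ r, (Fin (d r) → ℝ) → Matrix (Fin (d r)) (Fin (d r)) ℝ}
    (q : Config d) (Y : Idx d → ℝ) (r : Fin n) (u : Fin (d r) → ℝ) :
    ∑ b, velocity g q (ofBlocks (Pi.single r u)) b * Y b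
      = (fun i => Y ⟨r, i⟩) ⬝ᵥ g r (block q r) *ᵥ u := by
  rw [Fintype.sum_sigma, Finset.sum_eq_single r]
  · simp [velocity, dotProduct, mul_comm]
  · intro s _ hs
    simp [velocity, hs]
  · simp

/-- Two functions `∑ r, γ^r H_r` and `∑ r, δ^r H_r` are in involution over a point of the base if
and only if the coefficients satisfy `δ^r ∂_{r_i} γ^s = γ^r ∂_{r_i} δ^s` there. -/
theorem poisson_twisted_eq_zero_iff (hd : ∀ r, 1 ≤ d r) (hU : ∀ r, IsOpen (U r))
    (hg : ∀ r, IsMetricOn (U r) (g r)) (hV : ∀ r, ContDiffOn ℝ ∞ (V r) (U r))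
    {γ δ : Fin n → Config d → ℝ} {q : Config d} (hq : q ∈ base U)
    (hγ : ∀ r, DifferentiableAt ℝ (γ r) q) (hδ : ∀ r, DifferentiableAt ℝ (δ r) q) :
    (∀ p, poisson (twisted g V γ) (twisted g V δ) (q, p) = 0) ↔
      ∀ (b : Idx d) s, δ b.1 q * fderiv ℝ (γ s) q (Pi.single b 1)
        = γ b.1 q * fderiv ℝ (δ s) q (Pi.single b 1) := by
  constructor
  · intro h b s
    let B : Fin n → Config d →ₗ[ℝ] Config d →ₗ[ℝ] ℝ := fun s =>
      LinearMap.mk₂ ℝ (fun p p' => (1 / 2) * (block p s ⬝ᵥ g s (block q s) *ᵥ block p' s))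
        (fun p p' w => by simp [add_dotProduct, mul_add])
        (fun t p w => by simp; ring)
        (fun p p' w => by simp [mulVec_add, dotProduct_add, mul_add])
        (fun t p w => by simp [mulVec_smul]; ring)
    let Y : Fin n → Idx d → ℝ := fun s b => δ b.1 q * fderiv ℝ (γ s) q (Pi.single b 1)
      - γ b.1 q * fderiv ℝ (δ s) q (Pi.single b 1)
    let X : Fin n → Config d →ₗ[ℝ] ℝ := fun s =>
      { toFun := fun p => ∑ b, velocity g q p b * Y s b
        map_add' := fun p p' => by
          simp [velocity, mulVec_add, add_mul, Finset.sum_add_distrib]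
        map_smul' := fun t p => by
          simp [velocity, mulVec_smul, mul_assoc, Finset.mul_sum] }
    -- A momentum supported in block `s` and non-isotropic for `g_s` isolates the factor `H_s`.
    obtain ⟨u, hu⟩ := exists_dotProduct_mulVec_ne_zero (hd s) ((hg s).symm _ (hq s))
      ((hg s).nondegenerate _ (hq s))
    have hX : X s = 0 := by
      refine eq_zero_of_sum_quadratic_mul_linear B (fun s => V s (block q s)) X (fun p => ?_)
        (U := ofBlocks (Pi.single s u)) ?_ ?_
      · rw [← h p, poisson_twisted hU hg hV hq hγ hδ]
        refine Finset.sum_congr rfl fun s _ => ?_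
        rw [blockHamiltonian, naturalHamiltonian_eq]
        rfl
      · simpa [B] using hu
      · intro t ht W
        simp [B, ht]
    -- Momenta supported in the block of `b` are enough: as `g_r` is invertible, their velocities
    -- fill that block.
    have h1 : ∀ w, (fun i => Y s ⟨b.1, i⟩) ⬝ᵥ g b.1 (block q b.1) *ᵥ w = 0 := by
      intro w
      rw [← sum_single_velocity_mul]
      exact LinearMap.congr_fun hX _
    have h2 := Matrix.eq_zero_of_vecMul_eq_zero ((hg b.1).nondegenerate _ (hq b.1))
      (v := fun i => Y s ⟨b.1, i⟩) (by
        ext j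
        have := h1 (Pi.single j 1)
        rwa [dotProduct_mulVec, dotProduct_single_one] at this)
    exact sub_eq_zero.1 (congrFun h2 b.2)
  · intro h p
    rw [poisson_twisted hU hg hV hq hγ hδ]
    refine Finset.sum_eq_zero fun s _ => ?_
    rw [Finset.sum_eq_zero fun b _ => by rw [h b s, sub_self, mul_zero], mul_zero]

end Twisted

/-! ### Killing tensors, eigenspaces and functional independence -/

section Tensor

variable {n : ℕ} {d : Fin n → ℕ} {U : ∀ r, Set (Fin (d r) → ℝ)}
  {g : ∀ r, (Fin (d r) → ℝ) → Matrix (Fin (d r)) (Fin (d r)) ℝ}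
  {V : ∀ r, (Fin (d r) → ℝ) → ℝ}

/-- The potentials cancel in the polarization, and the two equal cross terms of the symmetric form
absorb the factor `1/2`. -/
theorem tensor_twisted (hg : ∀ r, IsMetricOn (U r) (g r)) (γ : Fin n → Config d → ℝ)
    {q : Config d} (hq : q ∈ base U) :
    tensor (twisted g V γ) q = Matrix.blockDiagonal' fun r => γ r q • g r (block q r) := by
  have key : ∀ b c, tensor (twisted g V γ) q b c = ∑ t, γ t q *
      (block (Pi.single b 1 : Config d) t ⬝ᵥ g t (block q t) *ᵥ block (Pi.single c 1) t) := by
    intro b c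
    simp only [tensor, Matrix.of_apply, twisted, naturalHamiltonian_eq,
      ← Finset.sum_sub_distrib, ← Finset.sum_add_distrib]
    refine Finset.sum_congr rfl fun t _ => ?_
    have hsymm : block (Pi.single c 1 : Config d) t ⬝ᵥ g t (block q t) *ᵥ
        block (Pi.single b 1) t = block (Pi.single b 1 : Config d) t ⬝ᵥ
          g t (block q t) *ᵥ block (Pi.single c 1) t := by
      rw [dotProduct_mulVec, ← mulVec_transpose, ((hg t).symm _ (hq t)).eq, dotProduct_comm]
    have h0 : block (0 : Config d) t = 0 := rfl
    simp only [block_add, mulVec_add, add_dotProduct, dotProduct_add, hsymm, h0, mulVec_zero,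
      dotProduct_zero]
    ring
  ext b c
  rw [key]
  obtain ⟨r, i⟩ := b
  obtain ⟨s, j⟩ := c
  by_cases h : r = s
  · subst h
    rw [Finset.sum_eq_single r, blockDiagonal'_apply_eq]
    · simp [block_single_self]
    · intro t _ ht
      rw [block_single_of_ne ht, zero_dotProduct, mul_zero]
    · simp
  · rw [blockDiagonal'_apply_ne _ _ _ h]
    refine Finset.sum_eq_zero fun t _ => ?_
    by_cases ht : t = r
    · rw [block_single_of_ne (b := ⟨s, j⟩) (by rw [ht]; exact h), mulVec_zero, dotProduct_zero,
        mul_zero]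
    · rw [block_single_of_ne (b := ⟨r, i⟩) ht, zero_dotProduct, mul_zero]

theorem fderiv_tensor_twisted (hU : ∀ r, IsOpen (U r)) (hg : ∀ r, IsMetricOn (U r) (g r))
    {γ : Fin n → Config d → ℝ} {q : Config d} (hq : q ∈ base U)
    (hγ : ∀ r, DifferentiableAt ℝ (γ r) q) (s : Fin n) (i j : Fin (d s)) (v : Config d) :
    fderiv ℝ (fun y => tensor (twisted g V γ) y ⟨s, i⟩ ⟨s, j⟩) q v =
      γ s q * fderiv ℝ (fun y => g s (block y s) i j) q v
        + g s (block q s) i j * fderiv ℝ (γ s) q v := by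
  have h1 : (fun y => tensor (twisted g V γ) y ⟨s, i⟩ ⟨s, j⟩) =ᶠ[𝓝 q]
      fun y => γ s y * g s (block y s) i j := by
    filter_upwards [(isOpen_base hU).mem_nhds hq] with y hy
    rw [tensor_twisted hg γ hy, blockDiagonal'_apply_eq]
    rfl
  have h2 : DifferentiableAt ℝ (fun y : Config d => g s (block y s) i j) q := by
    have h3 : DifferentiableAt ℝ (fun x => g s x i j) (block q s) :=
      (((hg s).smooth i j).differentiableOn (by simp)).differentiableAt ((hU s).mem_nhds (hq s))
    exact DifferentiableAt.comp q (f := blockCLM d s) h3 (blockCLM d s).differentiableAt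
  rw [h1.fderiv_eq, fderiv_fun_mul (hγ s) h2]
  simp

theorem fderiv_tensor_twisted_of_ne (hU : ∀ r, IsOpen (U r)) (hg : ∀ r, IsMetricOn (U r) (g r))
    {γ : Fin n → Config d → ℝ} {q : Config d} (hq : q ∈ base U) {c e : Idx d} (h : c.1 ≠ e.1) :
    fderiv ℝ (fun y => tensor (twisted g V γ) y c e) q = 0 := by
  have h1 : (fun y => tensor (twisted g V γ) y c e) =ᶠ[𝓝 q] fun _ => (0 : ℝ) := by
    filter_upwards [(isOpen_base hU).mem_nhds hq] with y hy
    rw [tensor_twisted hg γ hy]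
    exact blockDiagonal'_apply_ne _ _ _ h
  rw [h1.fderiv_eq, fderiv_fun_const]
  rfl

/-- The bracket vanishes before symmetrization. With `l, b` in block `r` and `c, e` in block `s`,
the derivatives of the coefficients cancel by `h`, and what remains is `(γ^r δ^s - δ^r γ^s) ∂_l
g_s`: the factor is zero if `r = s`, the derivative if `r ≠ s`. -/
theorem schoutenTerm_tensor_twisted (hU : ∀ r, IsOpen (U r))
    (hg : ∀ r, IsMetricOn (U r) (g r)) {γ δ : Fin n → Config d → ℝ} {q : Config d}
    (hq : q ∈ base U) (hγ : ∀ r, DifferentiableAt ℝ (γ r) q)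
    (hδ : ∀ r, DifferentiableAt ℝ (δ r) q)
    (h : ∀ (b : Idx d) s, δ b.1 q * fderiv ℝ (γ s) q (Pi.single b 1)
        = γ b.1 q * fderiv ℝ (δ s) q (Pi.single b 1)) (b c e : Idx d) :
    schoutenTerm (tensor (twisted g V γ)) (tensor (twisted g V δ)) q b c e = 0 := by
  refine Finset.sum_eq_zero fun l _ => ?_
  by_cases hce : c.1 = e.1
  · obtain ⟨s, i⟩ := c
    obtain ⟨s', j⟩ := e
    obtain rfl : s = s' := hce
    rw [fderiv_tensor_twisted hU hg hq hγ, fderiv_tensor_twisted hU hg hq hδ,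
      tensor_twisted hg γ hq, tensor_twisted hg δ hq]
    by_cases hlb : l.1 = b.1
    · obtain ⟨r, k⟩ := l
      obtain ⟨r', k'⟩ := b
      obtain rfl : r = r' := hlb
      have h1 := h ⟨r, k⟩ s
      simp only [blockDiagonal'_apply_eq, Matrix.smul_apply, smul_eq_mul] at h1 ⊢
      by_cases hs : s = r
      · subst hs
        linear_combination (-(g s (block q s) k k' * g s (block q s) i j)) * h1
      · have h3 : DifferentiableAt ℝ (fun x => g s x i j) (block q s) :=
          (((hg s).smooth i j).differentiableOn (by simp)).differentiableAt
            ((hU s).mem_nhds (hq s))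
        rw [fderiv_comp_block_single h3 (b := ⟨r, k⟩) hs]
        linear_combination (-(g r (block q r) k k' * g s (block q s) i j)) * h1
    · rw [show blockDiagonal' (fun r => γ r q • g r (block q r)) l b = 0 from
          blockDiagonal'_apply_ne _ _ _ hlb,
        show blockDiagonal' (fun r => δ r q • g r (block q r)) l b = 0 from
          blockDiagonal'_apply_ne _ _ _ hlb, zero_mul, zero_mul, sub_zero]
  · rw [fderiv_tensor_twisted_of_ne hU hg hq hce, fderiv_tensor_twisted_of_ne hU hg hq hce]
    simp

theorem isKillingOn_tensor_twisted (hU : ∀ r, IsOpen (U r))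
    (hg : ∀ r, IsMetricOn (U r) (g r)) {γ δ : Fin n → Config d → ℝ}
    (hγ : ∀ q ∈ base U, ∀ r, DifferentiableAt ℝ (γ r) q)
    (hδ : ∀ q ∈ base U, ∀ r, DifferentiableAt ℝ (δ r) q)
    (h : ∀ q ∈ base U, ∀ (b : Idx d) s, δ b.1 q * fderiv ℝ (γ s) q (Pi.single b 1)
        = γ b.1 q * fderiv ℝ (δ s) q (Pi.single b 1)) :
    IsKillingOn (base U) (tensor (twisted g V γ)) (tensor (twisted g V δ)) := by
  refine fun q hq => ⟨?_, fun b c e => ?_⟩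
  · rw [tensor_twisted hg δ hq, Matrix.IsSymm, blockDiagonal'_transpose]
    congr 1
    ext1 r
    rw [transpose_smul, ((hg r).symm _ (hq r)).eq]
  · simp only [schoutenTerm_tensor_twisted hU hg hq (hγ q hq) (hδ q hq) (h q hq), add_zero]

theorem areBlockDiagonalOn_tensor_twisted {ι : Type} (hg : ∀ r, IsMetricOn (U r) (g r))
    (β : ι → Fin n → Config d → ℝ) :
    AreBlockDiagonalOn (base U) fun a => tensor (twisted g V (β a)) := by
  intro q hq a b c hbc
  simp only [tensor_twisted hg (β a) hq]
  exact blockDiagonal'_apply_ne _ _ _ hbc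

/-- The tangent vectors to the `r`-block. -/
def blockSubspace (d : Fin n → ℕ) (r : Fin n) : Submodule ℝ (Config d) where
  carrier := {v | ∀ b : Idx d, b.1 ≠ r → v b = 0}
  add_mem' := fun hv hw b hb => by rw [Pi.add_apply, hv b hb, hw b hb, add_zero]
  zero_mem' := fun _ _ => rfl
  smul_mem' := fun t v hv b hb => by rw [Pi.smul_apply, hv b hb, smul_zero]

theorem mem_blockSubspace {r : Fin n} {v : Config d} :
    v ∈ blockSubspace d r ↔ ∀ b : Idx d, b.1 ≠ r → v b = 0 := Iff.rfl

theorem ofBlocks_single_mem (r : Fin n) (x : Fin (d r) → ℝ) :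
    ofBlocks (Pi.single r x) ∈ blockSubspace d r := by
  intro b hb
  simp [ofBlocks, hb]

theorem isInternal_blockSubspace : DirectSum.IsInternal (blockSubspace d) := by
  rw [DirectSum.isInternal_submodule_iff_iSupIndep_and_iSup_eq_top]
  constructor
  -- Multiplication by the number of the block: the block subspaces are its eigenspaces for distinct
  -- eigenvalues, hence independent.
  · let D : Module.End ℝ (Config d) :=
      LinearMap.pi fun b => ((b.1 : ℕ) : ℝ) • LinearMap.proj b
    have hD : blockSubspace d = D.eigenspace ∘ fun r : Fin n => ((r : ℕ) : ℝ) := by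
      ext r v
      simp only [mem_blockSubspace, Function.comp_apply, Module.End.mem_eigenspace_iff]
      constructor
      · intro hv
        ext b
        by_cases hb : b.1 = r
        · simp [D, hb]
        · simp [D, hv b hb]
      · intro hv b hb
        have h1 : ((b.1 : ℕ) : ℝ) * v b = ((r : ℕ) : ℝ) * v b := congrFun hv b
        by_contra h0
        exact hb (Fin.ext (Nat.cast_injective (mul_right_cancel₀ h0 h1)))
    rw [hD]
    exact D.eigenspaces_iSupIndep.comp (Nat.cast_injective.comp Fin.val_injective)
  · rw [eq_top_iff]
    intro v _
    have : v = ∑ r, ofBlocks (Pi.single r (block v r)) := by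
      ext b
      rw [Finset.sum_apply, Finset.sum_eq_single b.1]
      · simp [ofBlocks, block]
      · intro r _ hr
        simp [ofBlocks, hr.symm]
      · simp
    rw [this]
    exact Submodule.sum_mem _ fun r _ =>
      Submodule.mem_iSup_of_mem r (ofBlocks_single_mem r _)

theorem finrank_blockSubspace (r : Fin n) : Module.finrank ℝ (blockSubspace d r) = d r := by
  let e : blockSubspace d r ≃ₗ[ℝ] (Fin (d r) → ℝ) :=
    { toFun := fun v => block v.1 r
      map_add' := fun _ _ => rfl
      map_smul' := fun _ _ => rfl
      invFun := fun x => ⟨ofBlocks (Pi.single r x), ofBlocks_single_mem r x⟩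
      left_inv := by
        rintro ⟨v, hv⟩
        ext b
        by_cases hb : b.1 = r
        · obtain ⟨s, i⟩ := b
          obtain rfl : s = r := hb
          simp [ofBlocks, block]
        · simp [ofBlocks, hb, hv b hb]
      right_inv := fun x => by simp }
  rw [e.finrank_eq, Module.finrank_fin_fun]

theorem inv_blockDiagonal' {A : ∀ r, Matrix (Fin (d r)) (Fin (d r)) ℝ}
    (hA : ∀ r, (A r).det ≠ 0) :
    (Matrix.blockDiagonal' A)⁻¹ = Matrix.blockDiagonal' fun r => (A r)⁻¹ := by
  refine Matrix.inv_eq_right_inv ?_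
  rw [← blockDiagonal'_mul]
  simp_rw [fun r => Matrix.mul_nonsing_inv (A r) (hA r).isUnit]
  exact blockDiagonal'_one

theorem blockDiagonal'_mulVec_apply (A : ∀ r, Matrix (Fin (d r)) (Fin (d r)) ℝ) (v : Config d)
    (b : Idx d) : (Matrix.blockDiagonal' A *ᵥ v) b = (A b.1 *ᵥ block v b.1) b.2 := by
  obtain ⟨r, i⟩ := b
  rw [mulVec, dotProduct, Fintype.sum_sigma, Finset.sum_eq_single r]
  · simp [mulVec, dotProduct, block]
  · intro s _ hs
    exact Finset.sum_eq_zero fun j _ => by rw [blockDiagonal'_apply_ne _ _ _ hs.symm, zero_mul]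
  · simp

theorem det_smul_metric_ne_zero (hg : ∀ r, IsMetricOn (U r) (g r)) {γ : Fin n → Config d → ℝ}
    {q : Config d} (hq : q ∈ base U) (hγ : ∀ r, γ r q ≠ 0) (r : Fin n) :
    (γ r q • g r (block q r)).det ≠ 0 := by
  rw [Matrix.det_smul]
  exact mul_ne_zero (pow_ne_zero _ (hγ r)) ((hg r).nondegenerate _ (hq r))

/-- The endomorphism of a 2-tensor is multiplication by `δ^r / γ^r` on the `r`-block. -/
theorem mem_tensorEigenspace_twisted (hg : ∀ r, IsMetricOn (U r) (g r))
    {γ δ : Fin n → Config d → ℝ} {q : Config d} (hq : q ∈ base U) (hγ : ∀ r, γ r q ≠ 0) (μ : ℝ)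
    (v : Config d) :
    v ∈ tensorEigenspace (tensor (twisted g V γ) q) (tensor (twisted g V δ) q) μ ↔
      ∀ b : Idx d, δ b.1 q / γ b.1 q * v b = μ * v b := by
  have h1 : tensor (twisted g V δ) q * (tensor (twisted g V γ) q)⁻¹ =
      Matrix.diagonal fun b : Idx d => δ b.1 q / γ b.1 q := by
    rw [tensor_twisted hg γ hq, tensor_twisted hg δ hq,
      inv_blockDiagonal' (det_smul_metric_ne_zero hg hq hγ), ← blockDiagonal'_mul,
      ← blockDiagonal'_diagonal fun r (_ : Fin (d r)) => δ r q / γ r q]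
    congr 1
    ext1 r
    have h2 : (γ r q • g r (block q r))⁻¹ = (γ r q)⁻¹ • (g r (block q r))⁻¹ := by
      refine Matrix.inv_eq_right_inv ?_
      rw [Matrix.smul_mul, Matrix.mul_smul, smul_smul, mul_inv_cancel₀ (hγ r), one_smul,
        Matrix.mul_nonsing_inv _ ((hg r).nondegenerate _ (hq r)).isUnit]
    rw [h2, Matrix.smul_mul, Matrix.mul_smul,
      Matrix.mul_nonsing_inv _ ((hg r).nondegenerate _ (hq r)).isUnit, smul_smul,
      ← div_eq_mul_inv, Matrix.smul_one_eq_diagonal]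
  rw [tensorEigenspace, Module.End.mem_eigenspace_iff, h1, Matrix.toLin'_apply, funext_iff]
  simp [Matrix.mulVec_diagonal]

theorem mem_normalSpace_blockSubspace (hg : ∀ r, IsMetricOn (U r) (g r))
    {γ : Fin n → Config d → ℝ} {q : Config d} (hq : q ∈ base U) (hγ : ∀ r, γ r q ≠ 0)
    (r : Fin n) (v : Config d) :
    v ∈ normalSpace (tensor (twisted g V γ) q) (blockSubspace d r) ↔ block v r = 0 := by
  have hdet := det_smul_metric_ne_zero hg hq hγ
  rw [normalSpace, LinearMap.BilinForm.mem_orthogonal_iff, tensor_twisted hg γ hq,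
    inv_blockDiagonal' hdet]
  simp only [Matrix.toBilin'_apply']
  constructor
  · intro h
    have h1 : (γ r q • g r (block q r))⁻¹ *ᵥ block v r = 0 := by
      ext i
      have h2 := h (Pi.single ⟨r, i⟩ 1) (fun b hb => by
        rw [Pi.single_apply, if_neg fun e => hb (by rw [e])])
      rwa [single_one_dotProduct, blockDiagonal'_mulVec_apply] at h2
    exact Matrix.eq_zero_of_mulVec_eq_zero
      (Matrix.isUnit_nonsing_inv_det _ (hdet r).isUnit).ne_zero h1
  · intro h w hw
    refine Finset.sum_eq_zero fun b _ => ?_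
    by_cases hb : b.1 = r
    · subst hb
      rw [blockDiagonal'_mulVec_apply, h, mulVec_zero, Pi.zero_apply, mul_zero]
    · rw [hw b hb, zero_mul]

/-- The eigenvalues are the ratios `β_a^r / γ^r`. Since some `a` distinguishes any two blocks, each
common eigenspace is exactly one block, and its orthogonal is the kernel of the differential of that
block's coordinates. -/
theorem haveCommonNormalEigenspacesOn_twisted {ι : Type} (hU : ∀ r, IsOpen (U r))
    (hg : ∀ r, IsMetricOn (U r) (g r)) {γ : Fin n → Config d → ℝ}
    {β : ι → Fin n → Config d → ℝ} (hγ : ∀ q ∈ base U, ∀ r, γ r q ≠ 0)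
    (hβ : ∀ q ∈ base U, ∀ r s, r ≠ s → ∃ a, β a r q / γ r q ≠ β a s q / γ s q) :
    HaveCommonNormalEigenspacesOn (base U) (tensor (twisted g V γ))
      fun a => tensor (twisted g V (β a)) := by
  have hE : ∀ q ∈ base U, ∀ r, ⨅ a, tensorEigenspace (tensor (twisted g V γ) q)
      (tensor (twisted g V (β a)) q) (β a r q / γ r q) = blockSubspace d r := by
    intro q hq r
    ext v
    simp only [Submodule.mem_iInf, mem_tensorEigenspace_twisted hg hq (hγ q hq),
      mem_blockSubspace]
    constructor
    · intro hv b hb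
      obtain ⟨a, ha⟩ := hβ q hq _ _ hb
      by_contra h0
      exact ha (mul_right_cancel₀ h0 (hv a b))
    · intro hv a b
      by_cases hb : b.1 = r
      · rw [hb]
      · rw [hv b hb, mul_zero, mul_zero]
  refine ⟨fun r a q => β a r q / γ r q, fun q hq => ?_, fun q hq r => ?_, fun r q hq => ?_⟩
  · simp only [hE q hq]
    exact isInternal_blockSubspace
  · rw [hE q hq, finrank_blockSubspace]
  · refine ⟨base U, isOpen_base hU, hq, subset_rfl, d r, fun q => block q r,
      (contDiff_block r).contDiffOn, fun x hx => ?_⟩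
    have h1 : fderiv ℝ (fun q : Config d => block q r) x = blockCLM d r :=
      (blockCLM d r).fderiv
    simp only [hE x hx, h1, mem_normalSpace_blockSubspace hg hx (hγ x hx), blockCLM_apply,
      implies_true, and_true]
    exact fun y => ⟨ofBlocks (Pi.single r y), by simp⟩

/-- The momentum derivatives are the coefficients times the velocities, so independence of the
coefficient rows passes to the differentials wherever every block has a nonzero velocity. Momenta
with no zero component have this property and are dense. -/
theorem functionallyIndependentOn_twisted {ι : Type} (hd : ∀ r, 1 ≤ d r)
    (hU : ∀ r, IsOpen (U r)) (hg : ∀ r, IsMetricOn (U r) (g r))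
    (hV : ∀ r, ContDiffOn ℝ ∞ (V r) (U r)) {A : ι → Fin n → Config d → ℝ}
    (hA : ∀ q ∈ base U, ∀ a r, DifferentiableAt ℝ (A a r) q)
    (hli : ∀ q ∈ base U, LinearIndependent ℝ fun a r => A a r q) :
    FunctionallyIndependentOn (fun a => twisted g V (A a)) (cotangent U) := by
  rintro ⟨q, p⟩ hx
  have hq : q ∈ base U := hx
  -- Shifting all momenta by the same small `t ≠ 0` makes every component nonzero.
  have hlim : Tendsto (fun t : ℝ => ((q, p + t • 1) : Phase d)) (𝓝[≠] 0) (𝓝 (q, p)) := by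
    have : Continuous fun t : ℝ => ((q, p + t • 1) : Phase d) := by fun_prop
    simpa using (this.tendsto 0).mono_left nhdsWithin_le_nhds
  refine mem_closure_of_tendsto hlim ?_
  have hne : ∀ b : Idx d, ∀ᶠ t : ℝ in 𝓝[≠] 0, t ≠ -p b := by
    intro b
    by_cases h : (0 : ℝ) = -p b
    · rw [← h]
      exact self_mem_nhdsWithin
    · exact eventually_ne_nhdsWithin h
  filter_upwards [eventually_all.2 hne] with t ht
  refine ⟨hq, ?_⟩
  set p' : Config d := p + t • 1
  have hx' : ((q, p') : Phase d) ∈ cotangent U := hq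
  have hp : ∀ b, p' b ≠ 0 := by
    intro b hb
    apply ht b
    have : p b + t = 0 := by simpa [p'] using hb
    linarith
  have hvel : ∀ r, ∃ i, velocity g q p' ⟨r, i⟩ ≠ 0 := by
    intro r
    by_contra! h
    have h1 := Matrix.eq_zero_of_mulVec_eq_zero ((hg r).nondegenerate _ (hq r))
      (v := block p' r) (funext h)
    exact hp ⟨r, ⟨0, hd r⟩⟩ (congrFun h1 _)
  have hmap : LinearIndependent ℝ fun a =>
      (fun b => partialP (twisted g V (A a)) b (q, p') : Config d) := by
    let T : (Fin n → ℝ) →ₗ[ℝ] Config d :=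
      LinearMap.pi fun b => velocity g q p' b • LinearMap.proj b.1
    have hT : LinearMap.ker T = ⊥ := by
      rw [LinearMap.ker_eq_bot']
      intro w hw
      ext r
      obtain ⟨i, hi⟩ := hvel r
      have : velocity g q p' ⟨r, i⟩ * w r = 0 := congrFun hw ⟨r, i⟩
      exact (mul_eq_zero.1 this).resolve_left hi
    have hTA : (fun a b => partialP (twisted g V (A a)) b (q, p')) =
        T ∘ fun a r => A a r q := by
      ext a b
      rw [partialP_twisted hU hg hV hx' (hA q hq a)]
      simp [T, mul_comm]
    rw [hTA]
    exact (hli q hq).map' T hT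
  let R : (Phase d →L[ℝ] ℝ) →ₗ[ℝ] Config d :=
    LinearMap.pi fun b =>
      { toFun := fun L => L (0, Pi.single b 1)
        map_add' := fun _ _ => rfl
        map_smul' := fun _ _ => rfl }
  exact LinearIndependent.of_comp R hmap

end Tensor

/-! ### The linear system for the coefficients and Stäckel matrices -/

section Coefficients

variable {n : ℕ} {d : Fin n → ℕ} {U : ∀ r, Set (Fin (d r) → ℝ)}
  {g : ∀ r, (Fin (d r) → ℝ) → Matrix (Fin (d r)) (Fin (d r)) ℝ}
  {V : ∀ r, (Fin (d r) → ℝ) → ℝ}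

theorem differentiableAt_of_contDiffOn_base (hU : ∀ r, IsOpen (U r)) {f : Config d → ℝ}
    (hf : ContDiffOn ℝ ∞ f (base U)) {q : Config d} (hq : q ∈ base U) :
    DifferentiableAt ℝ f q :=
  (hf.differentiableOn (by simp)).differentiableAt ((isOpen_base hU).mem_nhds hq)

theorem continuousAt_fderiv_of_contDiffOn_base (hU : ∀ r, IsOpen (U r)) {f : Config d → ℝ}
    (hf : ContDiffOn ℝ ∞ f (base U)) {q : Config d} (hq : q ∈ base U) (v : Config d) :
    ContinuousAt (fun y => fderiv ℝ f y v) q :=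
  ((hf.continuousOn_fderiv_of_isOpen (isOpen_base hU) (by simp)).continuousAt
    ((isOpen_base hU).mem_nhds hq)).clm_apply continuousAt_const

theorem differentiableAt_twisted (hU : ∀ r, IsOpen (U r)) (hg : ∀ r, IsMetricOn (U r) (g r))
    (hV : ∀ r, ContDiffOn ℝ ∞ (V r) (U r)) {γ : Fin n → Config d → ℝ} {x : Phase d}
    (hx : x ∈ cotangent U) (hγ : ∀ r, DifferentiableAt ℝ (γ r) x.1) :
    DifferentiableAt ℝ (twisted g V γ) x :=
  DifferentiableAt.fun_sum fun s _ => ((hγ s).comp x differentiableAt_fst).mul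
    (hasFDerivAt_blockHamiltonian hU hg hV hx s).differentiableAt

theorem stackelMatrix_apply (S : ∀ r : Fin n, Fin n → (Fin (d r) → ℝ) → ℝ) (q : Config d)
    (r a : Fin n) : stackelMatrix S q r a = S r a (block q r) := rfl

theorem contDiffOn_stackelMatrix {S : ∀ r : Fin n, Fin n → (Fin (d r) → ℝ) → ℝ}
    (hS : ∀ r a, ContDiffOn ℝ ∞ (S r a) (U r)) (r a : Fin n) :
    ContDiffOn ℝ ∞ (fun q => stackelMatrix S q r a) (base U) :=
  (hS r a).comp (contDiff_block r).contDiffOn fun _ hq => hq r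

/-- In the inverse of a block-Stäckel matrix, the partial derivatives of the entries along the
`r`-block are those of a rank one matrix supported by the `r`-th column. -/
theorem exists_fderiv_inv_stackelMatrix (hU : ∀ r, IsOpen (U r))
    {S : ∀ r : Fin n, Fin n → (Fin (d r) → ℝ) → ℝ}
    (hS : ∀ r a, ContDiffOn ℝ ∞ (S r a) (U r))
    (hdet : ∀ q ∈ base U, (stackelMatrix S q).det ≠ 0) {q : Config d} (hq : q ∈ base U)
    (b : Idx d) (s : Fin n) :
    ∃ w : ℝ, ∀ a, fderiv ℝ (fun y => (stackelMatrix S y)⁻¹ a s) q (Pi.single b 1) =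
      (stackelMatrix S q)⁻¹ a b.1 * w := by
  have hsm := contDiffOn_stackelMatrix hS
  -- Only row `b.1` of `S` varies with the coordinate `b`, so one term of `-S⁻¹ dS S⁻¹` survives.
  refine ⟨-∑ l, fderiv ℝ (fun y => stackelMatrix S y b.1 l) q (Pi.single b 1) *
    (stackelMatrix S q)⁻¹ l s, fun a => ?_⟩
  rw [fderiv_inv_apply
    (fun i j => differentiableAt_of_contDiffOn_base hU (hsm i j) hq)
    (fun i j => differentiableAt_of_contDiffOn_base hU (contDiffOn_inv_apply hsm hdet i j) hq)
    (Filter.mem_of_superset ((isOpen_base hU).mem_nhds hq) hdet), Finset.sum_eq_single b.1]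
  · rw [mul_neg, Finset.mul_sum]
    simp only [mul_assoc]
  · intro k _ hk
    refine Finset.sum_eq_zero fun l _ => ?_
    simp only [stackelMatrix_apply]
    rw [fderiv_comp_block_single (((hS k l).differentiableOn (by simp)).differentiableAt
      ((hU k).mem_nhds (hq k))) hk]
    ring
  · simp

/-- If a combination, with constant coefficients, of solutions of the involutivity equations
vanishes at a point, it vanishes near that point. -/
theorem eventually_vecMul_eq_zero (hU : ∀ r, IsOpen (U r)) {α : Fin n → Config d → ℝ}
    (hα : ∀ r, ContDiffOn ℝ ∞ (α r) (base U)) (hα0 : ∀ r, ∀ q ∈ base U, α r q ≠ 0)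
    {A : Config d → Matrix (Fin n) (Fin n) ℝ}
    (hA : ∀ a r, ContDiffOn ℝ ∞ (fun q => A q a r) (base U))
    (hrel : ∀ q ∈ base U, ∀ (b : Idx d) a s, A q a b.1 * fderiv ℝ (α s) q (Pi.single b 1)
      = α b.1 q * fderiv ℝ (fun y => A y a s) q (Pi.single b 1))
    {q₀ : Config d} (hq₀ : q₀ ∈ base U) {c : Fin n → ℝ} (hc : c ᵥ* A q₀ = 0) :
    ∀ᶠ q in 𝓝 q₀, c ᵥ* A q = 0 := by
  have hbase := isOpen_base hU
  -- The vector `u = c A` satisfies `∂_b u_s = u_r (∂_b α^s / α^r)` for `b` in block `r`; `κ` bounds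
  -- this linear system and, being continuous at `q₀`, stays below `κ q₀ + 1` nearby.
  let κ : Config d → ℝ := fun q =>
    ∑ b : Idx d, ∑ s, |fderiv ℝ (α s) q (Pi.single b 1) / α b.1 q|
  have hκ : ContinuousAt κ q₀ := by
    refine tendsto_finsetSum _ fun b _ => tendsto_finsetSum _ fun s _ => ?_
    exact ((continuousAt_fderiv_of_contDiffOn_base hU (hα s) hq₀ _).div
      (differentiableAt_of_contDiffOn_base hU (hα b.1) hq₀).continuousAt
      (hα0 b.1 q₀ hq₀)).abs
  have hκ' : ∀ᶠ q in 𝓝 q₀, κ q < κ q₀ + 1 := hκ.eventually_lt_const (lt_add_one _)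
  refine eventually_eq_zero_of_norm_fderiv_le (C := κ q₀ + 1) ?_ hc
  filter_upwards [hκ', hbase.mem_nhds hq₀] with q hq1 hq
  have hAd : ∀ a r, DifferentiableAt ℝ (fun q => A q a r) q :=
    fun a r => differentiableAt_of_contDiffOn_base hU (hA a r) hq
  have hud : ∀ r, DifferentiableAt ℝ (fun q => (c ᵥ* A q) r) q := by
    intro r
    simp only [vecMul, dotProduct]
    exact DifferentiableAt.fun_sum fun a _ => (hAd a r).const_mul (c a)
  refine ⟨differentiableAt_pi.2 hud, ?_⟩
  have hpart : ∀ (b : Idx d) s, fderiv ℝ (fun q => (c ᵥ* A q) s) q (Pi.single b 1) =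
      (c ᵥ* A q) b.1 * (fderiv ℝ (α s) q (Pi.single b 1) / α b.1 q) := by
    intro b s
    have h1 : fderiv ℝ (fun q => (c ᵥ* A q) s) q =
        ∑ a, c a • fderiv ℝ (fun q => A q a s) q := by
      simp only [vecMul, dotProduct]
      rw [fderiv_fun_sum fun a _ => (hAd a s).const_mul (c a)]
      exact Finset.sum_congr rfl fun a _ => fderiv_const_mul (hAd a s) (c a)
    rw [h1, _root_.sum_apply, vecMul, dotProduct, Finset.sum_mul]
    refine Finset.sum_congr rfl fun a _ => ?_
    have h2 := hrel q hq b a s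
    have h3 := hα0 b.1 q hq
    rw [_root_.smul_apply, smul_eq_mul]
    field_simp
    linear_combination (-(c a)) * h2
  have hκ0 : 0 ≤ κ q := Finset.sum_nonneg fun _ _ => Finset.sum_nonneg fun _ _ => abs_nonneg _
  refine ContinuousLinearMap.opNorm_le_bound _ (by positivity [hκ0.trans hq1.le]) fun v => ?_
  refine (pi_norm_le_iff_of_nonneg (by positivity [hκ0.trans hq1.le])).2 fun s => ?_
  have hcomp : fderiv ℝ (fun q => c ᵥ* A q) q v s =
      fderiv ℝ (fun q => (c ᵥ* A q) s) q v := by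
    rw [fderiv_pi hud]
    rfl
  have hv : v = ∑ b, v b • (Pi.single b 1 : Config d) := by
    ext b
    simp [Pi.single_apply]
  rw [hcomp]
  conv_lhs => rw [hv, map_sum]
  calc ‖∑ b, fderiv ℝ (fun q => (c ᵥ* A q) s) q (v b • (Pi.single b 1 : Config d))‖
      ≤ ∑ b : Idx d, ‖c ᵥ* A q‖ * ‖v‖ * |fderiv ℝ (α s) q (Pi.single b 1) / α b.1 q| := by
        refine (norm_sum_le _ _).trans (Finset.sum_le_sum fun b _ => ?_)
        rw [map_smul, hpart, smul_eq_mul, norm_mul, norm_mul, ← mul_assoc, mul_comm ‖v b‖]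
        gcongr
        · exact norm_le_pi_norm (c ᵥ* A q) b.1
        · exact norm_le_pi_norm v b
        · exact le_rfl
    _ ≤ ‖c ᵥ* A q‖ * ‖v‖ * κ q := by
        rw [← Finset.mul_sum]
        refine mul_le_mul_of_nonneg_left (Finset.sum_le_sum fun b _ => ?_) (by positivity)
        exact Finset.single_le_sum
          (f := fun s => |fderiv ℝ (α s) q (Pi.single b 1) / α b.1 q|)
          (fun _ _ => abs_nonneg _) (Finset.mem_univ s)
    _ ≤ (κ q₀ + 1) * ‖c ᵥ* A q‖ * ‖v‖ := by
        rw [mul_comm _ (κ q), mul_assoc (κ q₀ + 1)]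
        gcongr

/-- A relation between the rows at `q` persists near `q` with the same constants, so a fixed
nontrivial combination of the twisted functions vanishes on an open set of phase space. Their
differentials are dependent there, against density. -/
theorem det_ne_zero_of_functionallyIndependentOn (hU : ∀ r, IsOpen (U r))
    (hg : ∀ r, IsMetricOn (U r) (g r)) (hV : ∀ r, ContDiffOn ℝ ∞ (V r) (U r))
    {α : Fin n → Config d → ℝ} (hα : ∀ r, ContDiffOn ℝ ∞ (α r) (base U))
    (hα0 : ∀ r, ∀ q ∈ base U, α r q ≠ 0) {A : Fin n → Fin n → Config d → ℝ}
    (hA : ∀ a r, ContDiffOn ℝ ∞ (A a r) (base U))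
    (hrel : ∀ q ∈ base U, ∀ (b : Idx d) a s, A a b.1 q * fderiv ℝ (α s) q (Pi.single b 1)
      = α b.1 q * fderiv ℝ (A a s) q (Pi.single b 1))
    (hind : FunctionallyIndependentOn (fun a => twisted g V (A a)) (cotangent U))
    {q : Config d} (hq : q ∈ base U) : (Matrix.of fun a r => A a r q).det ≠ 0 := by
  intro hdet
  obtain ⟨c, hc0, hc⟩ := Matrix.exists_vecMul_eq_zero_iff.2 hdet
  have hev : ∀ᶠ y in 𝓝 q, c ᵥ* Matrix.of (fun a r => A a r y) = 0 :=
    eventually_vecMul_eq_zero hU hα hα0 (A := fun y => Matrix.of fun a r => A a r y) hA hrel hq hc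
  have hev' : ∀ᶠ x : Phase d in 𝓝 (q, 0), ∑ a, c a * twisted g V (A a) x = 0 := by
    filter_upwards [continuousAt_fst.eventually hev] with x hx
    simp only [twisted, Finset.mul_sum]
    rw [Finset.sum_comm]
    refine Finset.sum_eq_zero fun r _ => ?_
    have h1 : ∑ a, c a * A a r x.1 = 0 := congrFun hx r
    simp only [← mul_assoc, ← Finset.sum_mul, h1, zero_mul]
  obtain ⟨x, hx, hxU, hli⟩ := mem_closure_iff_nhds.1
    (hind (show ((q, 0) : Phase d) ∈ cotangent U from hq)) _ hev'.eventually_nhds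
  have hzero : ∑ a, c a • fderiv ℝ (twisted g V (A a)) x = 0 := by
    have h1 : (fun x => ∑ a, c a * twisted g V (A a) x) =ᶠ[𝓝 x] fun _ => (0 : ℝ) := hx
    have hdiff : ∀ a, DifferentiableAt ℝ (twisted g V (A a)) x := fun a =>
      differentiableAt_twisted hU hg hV hxU fun r =>
        differentiableAt_of_contDiffOn_base hU (hA a r) hxU
    have h2 := h1.fderiv_eq (𝕜 := ℝ)
    rw [fderiv_fun_sum fun a _ => (hdiff a).const_mul (c a), fderiv_fun_const] at h2
    rw [← Finset.sum_congr rfl fun a _ => fderiv_const_mul (hdiff a) (c a), h2]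
    rfl
  exact hc0 (funext (Fintype.linearIndependent_iff.1 hli c hzero))

/-- An invertible matrix of solutions of the involutivity equations is the inverse of a
block-Stäckel matrix. -/
theorem exists_stackelMatrix_eq_inv (hU : ∀ r, IsOpen (U r)) (hUc : ∀ r, IsConnected (U r))
    {α : Fin n → Config d → ℝ} (hα0 : ∀ r, ∀ q ∈ base U, α r q ≠ 0)
    {A : Config d → Matrix (Fin n) (Fin n) ℝ}
    (hA : ∀ a r, ContDiffOn ℝ ∞ (fun q => A q a r) (base U))
    (hrel : ∀ q ∈ base U, ∀ (b : Idx d) a s, A q a b.1 * fderiv ℝ (α s) q (Pi.single b 1)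
      = α b.1 q * fderiv ℝ (fun y => A y a s) q (Pi.single b 1))
    (hdet : ∀ q ∈ base U, (A q).det ≠ 0) :
    ∃ S : ∀ r : Fin n, Fin n → (Fin (d r) → ℝ) → ℝ,
      (∀ r a, ContDiffOn ℝ ∞ (S r a) (U r)) ∧ ∀ q ∈ base U, stackelMatrix S q = (A q)⁻¹ := by
  obtain ⟨q₀, hq₀⟩ := base_nonempty fun r => (hUc r).nonempty
  have hinv := contDiffOn_inv_apply hA hdet
  -- Row `r` of `S` is row `r` of `A⁻¹` with the other blocks frozen at `q₀`.
  let ins : ∀ r, (Fin (d r) → ℝ) → Config d := fun r x =>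
    ofBlocks (Function.update (fun s => block q₀ s) r x)
  have hins : ∀ r x, block (ins r x) r = x := fun r x => by simp [ins]
  have hmem : ∀ r, ∀ x ∈ U r, ins r x ∈ base U := by
    intro r x hx s
    by_cases hs : s = r
    · subst hs
      rwa [hins]
    · simpa [ins, hs] using hq₀ s
  have hsmooth : ∀ r, ContDiff ℝ ∞ (ins r) := by
    intro r
    refine contDiff_pi.2 fun b => ?_
    by_cases hb : b.1 = r
    · obtain ⟨s, i⟩ := b
      obtain rfl : s = r := hb
      simpa [ins, ofBlocks] using contDiff_apply ℝ ℝ i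
    · simpa [ins, ofBlocks, hb] using contDiff_const
  refine ⟨fun r a x => (A (ins r x))⁻¹ r a, fun r a =>
    (hinv r a).comp (hsmooth r).contDiffOn (hmem r), fun q hq => ?_⟩
  ext r a
  rw [stackelMatrix_apply]
  refine eq_of_block_eq hU (fun r => (hUc r).isPreconnected) (f := fun y => (A y)⁻¹ r a) (s := r)
    ((hinv r a).differentiableOn (by simp)) (fun y hy b hb => ?_) (hmem r _ (hq r)) hq
    (hins r _)
  rw [fderiv_inv_apply
    (fun i j => differentiableAt_of_contDiffOn_base hU (hA i j) hy)
    (fun i j => differentiableAt_of_contDiffOn_base hU (hinv i j) hy)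
    (Filter.mem_of_superset ((isOpen_base hU).mem_nhds hy) hdet), neg_eq_zero, Finset.sum_comm]
  refine Finset.sum_eq_zero fun l _ => ?_
  -- The system turns `∂_b A` into column `b.1` of `A` times a row vector, so `d(A⁻¹)` contains this
  -- off-diagonal entry of `A⁻¹ A`.
  have h1 : ∑ k, (A y)⁻¹ r k * A y k b.1 = 0 := by
    rw [← Matrix.mul_apply, Matrix.nonsing_inv_mul _ (hdet y hy).isUnit,
      Matrix.one_apply_ne hb.symm]
  calc ∑ k, (A y)⁻¹ r k * fderiv ℝ (fun y => A y k l) y (Pi.single b 1) * (A y)⁻¹ l a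
      = ∑ k, (A y)⁻¹ r k * A y k b.1 *
          (fderiv ℝ (α l) y (Pi.single b 1) / α b.1 y * (A y)⁻¹ l a) := by
        refine Finset.sum_congr rfl fun k _ => ?_
        have h2 := hrel y hy b k l
        have h3 := hα0 b.1 y hy
        field_simp
        linear_combination (-((A y)⁻¹ r k * (A y)⁻¹ l a)) * h2
    _ = 0 := by rw [← Finset.sum_mul, h1, zero_mul]

end Coefficients

/-! ### The equivalence and the involution of the integrals -/

section Main

variable {m : ℕ} {d : Fin (m + 1) → ℕ} {U : ∀ r, Set (Fin (d r) → ℝ)}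
  {g : ∀ r, (Fin (d r) → ℝ) → Matrix (Fin (d r)) (Fin (d r)) ℝ}
  {V : ∀ r, (Fin (d r) → ℝ) → ℝ} {α : Fin (m + 1) → Config d → ℝ}
  {β : Fin m → Fin (m + 1) → Config d → ℝ}

theorem AreFirstIntegrals.rel (hd : ∀ r, 1 ≤ d r) (hU : ∀ r, IsOpen (U r))
    (hg : ∀ r, IsMetricOn (U r) (g r)) (hV : ∀ r, ContDiffOn ℝ ∞ (V r) (U r))
    (hα : ∀ r, ContDiffOn ℝ ∞ (α r) (base U)) (h : AreFirstIntegrals U g V α β) (a : Fin m)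
    {q : Config d} (hq : q ∈ base U) (b : Idx d) (s : Fin (m + 1)) :
    β a b.1 q * fderiv ℝ (α s) q (Pi.single b 1)
      = α b.1 q * fderiv ℝ (β a s) q (Pi.single b 1) :=
  (poisson_twisted_eq_zero_iff hd hU hg hV hq
    (fun r => differentiableAt_of_contDiffOn_base hU (hα r) hq)
    (fun r => differentiableAt_of_contDiffOn_base hU (h.1 a r) hq)).1
    (fun p => h.2.2 a (q, p) hq) b s

theorem AreFirstIntegrals.isBlockSeparated (hd : ∀ r, 1 ≤ d r) (hU : ∀ r, IsOpen (U r))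
    (hUc : ∀ r, IsConnected (U r)) (hg : ∀ r, IsMetricOn (U r) (g r))
    (hV : ∀ r, ContDiffOn ℝ ∞ (V r) (U r)) (hα : ∀ r, ContDiffOn ℝ ∞ (α r) (base U))
    (hα0 : ∀ r, ∀ q ∈ base U, α r q ≠ 0) (h : AreFirstIntegrals U g V α β) :
    IsBlockSeparated U α := by
  -- With `α` as row 0 and `S = A⁻¹`, the first row of `S⁻¹` is `α`.
  let A : Fin (m + 1) → Fin (m + 1) → Config d → ℝ := Fin.cons α β
  have hA : ∀ a r, ContDiffOn ℝ ∞ (A a r) (base U) := by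
    intro a
    cases a using Fin.cases with
    | zero => exact hα
    | succ a => exact h.1 a
  have hrel : ∀ q ∈ base U, ∀ (b : Idx d) a s, A a b.1 q * fderiv ℝ (α s) q (Pi.single b 1)
      = α b.1 q * fderiv ℝ (A a s) q (Pi.single b 1) := by
    intro q hq b a s
    cases a using Fin.cases with
    | zero => rfl
    | succ a => exact h.rel hd hU hg hV hα a hq b s
  have hind : FunctionallyIndependentOn (fun a => twisted g V (A a)) (cotangent U) := by
    refine h.2.1.trans (closure_mono fun x hx => ⟨hx.1, ?_⟩)
    convert hx.2.comp _ (finSuccEquiv m).injective using 1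
    ext1 a
    cases a using Fin.cases with
    | zero => simp [A]
    | succ a => simp [A]
  have hdet := fun q (hq : q ∈ base U) =>
    det_ne_zero_of_functionallyIndependentOn hU hg hV hα hα0 hA hrel hind hq
  obtain ⟨S, hS, hSA⟩ := exists_stackelMatrix_eq_inv hU hUc hα0
    (A := fun q => Matrix.of fun a r => A a r q) hA hrel hdet
  refine ⟨S, hS, fun q hq => ?_⟩
  rw [hSA q hq]
  refine ⟨Matrix.isUnit_nonsing_inv_det _ (hdet q hq).isUnit, fun r => ?_⟩
  rw [Matrix.nonsing_inv_nonsing_inv _ (hdet q hq).isUnit]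
  rfl

theorem IsBlockSeparated.exists_firstIntegrals (hd : ∀ r, 1 ≤ d r) (hU : ∀ r, IsOpen (U r))
    (hg : ∀ r, IsMetricOn (U r) (g r)) (hV : ∀ r, ContDiffOn ℝ ∞ (V r) (U r))
    (hα : ∀ r, ContDiffOn ℝ ∞ (α r) (base U)) (hα0 : ∀ r, ∀ q ∈ base U, α r q ≠ 0)
    (h : IsBlockSeparated U α) :
    ∃ β : Fin m → Fin (m + 1) → Config d → ℝ,
      AreFirstIntegrals U g V α β ∧ HaveBlockKillingTensors U g V α β := by
  obtain ⟨S, hS, hSα⟩ := h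
  have hdet : ∀ q ∈ base U, (stackelMatrix S q).det ≠ 0 := fun q hq => (hSα q hq).1.ne_zero
  have hinv := contDiffOn_inv_apply (contDiffOn_stackelMatrix hS) hdet
  let β : Fin m → Fin (m + 1) → Config d → ℝ := fun a r q => (stackelMatrix S q)⁻¹ a.succ r
  have hαd : ∀ q ∈ base U, ∀ r, DifferentiableAt ℝ (α r) q := fun q hq r =>
    differentiableAt_of_contDiffOn_base hU (hα r) hq
  have hβd : ∀ a, ∀ q ∈ base U, ∀ r, DifferentiableAt ℝ (β a r) q := fun a q hq r =>
    differentiableAt_of_contDiffOn_base hU (hinv _ _) hq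
  have hrel : ∀ a, ∀ q ∈ base U, ∀ (b : Idx d) s,
      β a b.1 q * fderiv ℝ (α s) q (Pi.single b 1)
        = α b.1 q * fderiv ℝ (β a s) q (Pi.single b 1) := by
    intro a q hq b s
    -- The same `w` serves row 0, which is `α`, and row `a.succ`, so both sides equal `α^r β_a^r w`.
    obtain ⟨w, hw⟩ := exists_fderiv_inv_stackelMatrix hU hS hdet hq b s
    have h1 : α s =ᶠ[𝓝 q] fun y => (stackelMatrix S y)⁻¹ 0 s := by
      filter_upwards [(isOpen_base hU).mem_nhds hq] with y hy using (hSα y hy).2 s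
    rw [h1.fderiv_eq, hw 0, (hSα q hq).2 b.1, hw a.succ]
    simp only [β]
    ring
  refine ⟨β, ⟨fun a r => hinv _ _, ?_, fun a x hx => ?_⟩,
    fun a => isKillingOn_tensor_twisted hU hg hαd (hβd a) (hrel a),
    areBlockDiagonalOn_tensor_twisted hg β,
    haveCommonNormalEigenspacesOn_twisted hU hg (fun q hq r => hα0 r q hq) fun q hq r s hrs => ?_⟩
  · have hopt : (fun o : Option (Fin m) => o.elim (twisted g V α) fun a => twisted g V (β a)) =
        fun o : Option (Fin m) => twisted g V (o.elim α β) := by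
      ext1 o
      cases o <;> rfl
    rw [hopt]
    refine functionallyIndependentOn_twisted hd hU hg hV (fun q hq o => ?_) fun q hq => ?_
    · cases o with
      | none => exact hαd q hq
      | some a => exact hβd a q hq
    · have hli : LinearIndependent ℝ fun a r => (stackelMatrix S q)⁻¹ a r :=
        Matrix.linearIndependent_rows_iff_isUnit.2
          ((Matrix.isUnit_iff_isUnit_det _).2 (Matrix.isUnit_nonsing_inv_det _ (hSα q hq).1))
      convert hli.comp _ (finSuccEquiv m).symm.injective using 1
      ext o r
      cases o with
      | none => simp [(hSα q hq).2 r]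
      | some a => simp [β]
  · exact (poisson_twisted_eq_zero_iff hd hU hg hV hx (hαd _ hx) (hβd a _ hx)).2
      (hrel a _ hx) x.2
  · by_contra! hall
    have hα' := (hSα q hq).2
    -- If no ratio distinguished `r` from `s`, columns `r` and `s` of `S⁻¹` divided by `α^r` and
    -- `α^s` would agree (row 0 reads `1 = 1`), and `w` would be a nonzero kernel vector.
    let w : Fin (m + 1) → ℝ := Pi.single r (α r q)⁻¹ - Pi.single s (α s q)⁻¹
    have hw : (stackelMatrix S q)⁻¹ *ᵥ w = 0 := by
      ext a
      have h1 : (stackelMatrix S q)⁻¹ a r * (α r q)⁻¹ = (stackelMatrix S q)⁻¹ a s * (α s q)⁻¹ := by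
        cases a using Fin.cases with
        | zero =>
          rw [← hα', ← hα', mul_inv_cancel₀ (hα0 r q hq), mul_inv_cancel₀ (hα0 s q hq)]
        | succ a => simpa only [div_eq_mul_inv] using hall a
      simp [w, mulVec_sub, h1]
    have h2 := Matrix.eq_zero_of_mulVec_eq_zero
      (Matrix.isUnit_nonsing_inv_det _ (hSα q hq).1).ne_zero hw
    have h3 := congrFun h2 r
    simp [w, hrs, hα0 r q hq] at h3

/-- After multiplication by `α^r`, both sides of the system for `β_a` and `β_b` become `β_a^r β_b^r
∂_c α^s`, with `c` in block `r`; then `α^r ≠ 0` cancels. -/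
theorem AreFirstIntegrals.poisson_eq_zero (hd : ∀ r, 1 ≤ d r) (hU : ∀ r, IsOpen (U r))
    (hg : ∀ r, IsMetricOn (U r) (g r)) (hV : ∀ r, ContDiffOn ℝ ∞ (V r) (U r))
    (hα : ∀ r, ContDiffOn ℝ ∞ (α r) (base U)) (hα0 : ∀ r, ∀ q ∈ base U, α r q ≠ 0)
    (h : AreFirstIntegrals U g V α β) (a b : Fin m) {x : Phase d} (hx : x ∈ cotangent U) :
    poisson (twisted g V (β a)) (twisted g V (β b)) x = 0 := by
  have hβd : ∀ a r, DifferentiableAt ℝ (β a r) x.1 := fun a r =>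
    differentiableAt_of_contDiffOn_base hU (h.1 a r) hx
  refine (poisson_twisted_eq_zero_iff hd hU hg hV hx (hβd a) (hβd b)).2 (fun c s => ?_) x.2
  have h1 := h.rel hd hU hg hV hα a hx c s
  have h2 := h.rel hd hU hg hV hα b hx c s
  refine mul_left_cancel₀ (hα0 c.1 x.1 hx) ?_
  linear_combination β a c.1 x.1 * h2 - β b c.1 x.1 * h1

end Main

end BlockSep

theorem propositionp6 (m : ℕ) (d : Fin (m + 1) → ℕ) (hd : ∀ r, 1 ≤ d r)
    (U : ∀ r, Set (Fin (d r) → ℝ)) (hUo : ∀ r, IsOpen (U r)) (hUc : ∀ r, IsConnected (U r))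
    (g : ∀ r, (Fin (d r) → ℝ) → Matrix (Fin (d r)) (Fin (d r)) ℝ)
    (hg : ∀ r, BlockSep.IsMetricOn (U r) (g r))
    (V : ∀ r, (Fin (d r) → ℝ) → ℝ) (hV : ∀ r, ContDiffOn ℝ ∞ (V r) (U r))
    (α : Fin (m + 1) → BlockSep.Config d → ℝ)
    (hα : ∀ r, ContDiffOn ℝ ∞ (α r) (BlockSep.base U))
    (hα0 : ∀ r, ∀ q ∈ BlockSep.base U, α r q ≠ 0) :
    (BlockSep.IsBlockSeparated U α ↔
      ∃ β : Fin m → Fin (m + 1) → BlockSep.Config d → ℝ,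
        BlockSep.AreFirstIntegrals U g V α β ∧ BlockSep.HaveBlockKillingTensors U g V α β) ∧
    ∀ β : Fin m → Fin (m + 1) → BlockSep.Config d → ℝ,
      BlockSep.AreFirstIntegrals U g V α β → BlockSep.HaveBlockKillingTensors U g V α β →
      ∀ a b, ∀ x ∈ BlockSep.cotangent U,
        BlockSep.poisson (BlockSep.twisted g V (β a)) (BlockSep.twisted g V (β b)) x = 0 :=
  ⟨⟨fun h => h.exists_firstIntegrals hd hUo hg hV hα hα0,
    fun ⟨_, h, _⟩ => h.isBlockSeparated hd hUo hUc hg hV hα hα0⟩,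
    fun _ h _ a b _ hx => h.poisson_eq_zero hd hUo hg hV hα hα0 a b hx⟩
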